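/- Let $k$ be a field and let $A=k\langle G\rangle/(F)$ be a connected monomial algebra: $G$ is a finite set of letters, $F$ is a finite set of words in these letters (the forbidden words), and $A$ is $\mathbb N$-graded by giving each letter $x\in G$ a degree $\deg x\ge 1$. A word is legal if it does not lie in the ideal $(F)$, i.e. if no forbidden word is a subword of it. Let $L_n$ be the set of legal words of length $n$, and let $\ell+1$ be the maximal length of a forbidden word (with $\ell=0$ if there is no non-empty forbidden word). The weighted Ufnarovskii graph $Q(A)$ is the quiver with vertex set $L_\ell$ and arrow set $L_{\ell+1}$ in which the arrow $\vec w$ given by $w=vy=xu$ ($x,y\in G$, $u,v\in L_\ell$) goes from $v$ to $u$, has label $x$, and has degree $\deg \vec w=\deg x$. Let $kQ(A)$ be its path algebra (the product $pq$ of paths is "first $p$, then $q$"), graded by these degrees, and let $f:A\to kQ(A)$ be the homomorphism of graded algebras that sends each letter $x$ to the sum of all arrows labelled $x$. For an $\mathbb N$-graded $k$-algebra $R$ let $\mathrm{Gr}\,R$ be the category of $\mathbb Z$-graded right $R$-modules and degree-preserving homomorphisms. Let $\mathrm{Fdim}\,A\subseteq \mathrm{Gr}\,A$ be the full subcategory of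 the modules that are the sum of their finite-dimensional submodules, let $\mathrm{QGr}\,A=\mathrm{Gr}\,A/\mathrm{Fdim}\,A$, and let $T_A\subseteq\mathrm{Gr}\,kQ(A)$ be the full subcategory of the modules whose restriction to $A$ along $f$ lies in $\mathrm{Fdim}\,A$. Then $\mathrm{Fdim}\,A$ and $T_A$ are localizing subcategories (closed under subobjects, quotients, extensions and direct sums), and $-\otimes_A kQ(A)$ induces an equivalence of categories $$\mathrm{QGr}\,A\;\equiv\;\frac{\mathrm{Gr}\,kQ(A)}{T_A},$$ that is, there is an equivalence $\Phi:\mathrm{QGr}\,A\to \mathrm{Gr}\,kQ(A)/T_A$ whose composite with the quotient functor $\mathrm{Gr}\,A\to\mathrm{QGr}\,A$ is naturally isomorphic to the composite of $-\otimes_A kQ(A):\mathrm{Gr}\,A\to\mathrm{Gr}\,kQ(A)$ with the quotient functor $\mathrm{Gr}\,kQ(A)\to\mathrm{Gr}\,kQ(A)/T_A$. -/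

import Mathlib

open CategoryTheory DirectSum TensorProduct MulOpposite

universe u v v' w

noncomputable section

namespace MonomialQGr

/-- A family of submodules with compatible projections whose sum is everything is an internal
direct sum. -/
theorem isInternal_of_proj {ι k T : Type*} [DecidableEq ι] [Field k] [AddCommGroup T] [Module k T]
    (gr : ι → Submodule k T) (π : ι → T →ₗ[k] T)
    (h1 : ∀ i, ∀ x ∈ gr i, π i x = x) (h2 : ∀ i j, i ≠ j → ∀ x ∈ gr i, π j x = 0)
    (h3 : ⨆ i, gr i = ⊤) : DirectSum.IsInternal gr := by
  refine DirectSum.isInternal_submodule_of_iSupIndep_of_iSup_eq_top ?_ h3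
  intro i
  rw [Submodule.disjoint_def]
  intro x hx hx'
  have : (⨆ j, ⨆ (_ : j ≠ i), gr j) ≤ LinearMap.ker (π i) :=
    iSup₂_le fun j hj y hy => h2 j i hj y hy
  rw [← h1 i x hx]
  exact this hx'

section GradedModules

variable {k : Type u} [Field k] {A : Type v} [Ring A] [Algebra k A]

/-- A `ℤ`-graded right module over an `ℕ`-graded `k`-algebra `A` with homogeneous components
`𝓐 n`.  Right `A`-modules are modules over `Aᵐᵒᵖ`: the element `m · a` is `op a • m`. -/
structure GrMod (𝓐 : ℕ → Submodule k A) where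
  /-- the underlying type -/
  carrier : Type w
  [addCommGroup : AddCommGroup carrier]
  [moduleBase : Module k carrier]
  [moduleRight : Module Aᵐᵒᵖ carrier]
  [tower : IsScalarTower k Aᵐᵒᵖ carrier]
  /-- the homogeneous components -/
  gr : ℤ → Submodule k carrier
  [dec : DirectSum.Decomposition gr]
  smul_mem : ∀ {i : ℤ} {n : ℕ} {m : carrier} {a : A},
    m ∈ gr i → a ∈ 𝓐 n → op a • m ∈ gr (i + n)

attribute [instance] GrMod.addCommGroup GrMod.moduleBase GrMod.moduleRight GrMod.tower GrMod.dec

namespace GrMod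

variable {𝓐 : ℕ → Submodule k A}

/-- Degree-preserving homomorphisms of graded right modules. -/
@[ext]
structure Hom (M N : GrMod.{u, v, w} 𝓐) where
  /-- the underlying `A`-linear map -/
  lin : M.carrier →ₗ[Aᵐᵒᵖ] N.carrier
  map_mem : ∀ (i : ℤ) (m : M.carrier), m ∈ M.gr i → lin m ∈ N.gr i

instance : Category (GrMod.{u, v, w} 𝓐) where
  Hom := Hom
  id _ := ⟨LinearMap.id, fun _ _ h => h⟩
  comp f g := ⟨g.lin ∘ₗ f.lin, fun i m h => g.map_mem i _ (f.map_mem i m h)⟩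

instance : Limits.HasZeroMorphisms (GrMod.{u, v, w} 𝓐) where
  zero _ N := ⟨⟨0, fun i _ _ => (N.gr i).zero_mem⟩⟩
  comp_zero _ _ := rfl
  zero_comp _ _ _ f := Hom.ext (LinearMap.ext fun _ => map_zero f.lin)

/-- The homogeneous component of degree `i` of an element. -/
def proj (M : GrMod.{u, v, w} 𝓐) (i : ℤ) : M.carrier →ₗ[k] M.carrier :=
  (M.gr i).subtype ∘ₗ DirectSum.component k ℤ (fun j => M.gr j) i ∘ₗ
    (DirectSum.decomposeLinearEquiv M.gr).toLinearMap

theorem proj_apply (M : GrMod.{u, v, w} 𝓐) (i : ℤ) (m : M.carrier) :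
    M.proj i m = (DirectSum.decompose M.gr m i : M.carrier) := rfl

theorem proj_mem (M : GrMod.{u, v, w} 𝓐) (i : ℤ) (m : M.carrier) : M.proj i m ∈ M.gr i :=
  (DirectSum.decompose M.gr m i).2

theorem proj_same (M : GrMod.{u, v, w} 𝓐) {i : ℤ} {m : M.carrier} (h : m ∈ M.gr i) :
    M.proj i m = m := DirectSum.decompose_of_mem_same M.gr h

theorem proj_ne (M : GrMod.{u, v, w} 𝓐) {i j : ℤ} {m : M.carrier} (h : m ∈ M.gr i)
    (hij : i ≠ j) : M.proj j m = 0 := DirectSum.decompose_of_mem_ne M.gr h hij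

theorem iSup_gr (M : GrMod.{u, v, w} 𝓐) : ⨆ i, M.gr i = ⊤ :=
  (DirectSum.Decomposition.isInternal M.gr).submodule_iSup_eq_top

theorem proj_smul (M : GrMod.{u, v, w} 𝓐) {n : ℕ} {a : A} (ha : a ∈ 𝓐 n) (i : ℤ)
    (m : M.carrier) : M.proj i (op a • m) = op a • M.proj (i - n) m := by
  have : M.proj i ∘ₗ Algebra.lsmul k k M.carrier (op a) =
      Algebra.lsmul k k M.carrier (op a) ∘ₗ M.proj (i - n) := by
    refine DirectSum.decompose_lhom_ext M.gr fun j => LinearMap.ext fun x => ?_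
    by_cases h : j = i - n
    · subst h
      have := M.smul_mem x.2 ha
      rw [sub_add_cancel] at this
      simp [M.proj_same x.2, M.proj_same this]
    · have := M.smul_mem x.2 ha
      have h' : j + (n : ℤ) ≠ i := fun e => h (by omega)
      simp [M.proj_ne x.2 h, M.proj_ne this h']
  exact LinearMap.congr_fun this m

/-- Homogeneous (graded) submodules: those closed under taking homogeneous components. -/
def IsGradedSub (M : GrMod.{u, v, w} 𝓐) (K : Submodule Aᵐᵒᵖ M.carrier) : Prop :=
  ∀ m ∈ K, ∀ i : ℤ, M.proj i m ∈ K

theorem Hom.proj_comm {M N : GrMod.{u, v, w} 𝓐} (f : M ⟶ N) (i : ℤ) (m : M.carrier) :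
    f.lin (M.proj i m) = N.proj i (f.lin m) := by
  have : (f.lin.restrictScalars k) ∘ₗ M.proj i = N.proj i ∘ₗ f.lin.restrictScalars k := by
    refine DirectSum.decompose_lhom_ext M.gr fun j => LinearMap.ext fun x => ?_
    by_cases h : j = i
    · subst h
      simp [M.proj_same x.2, N.proj_same (f.map_mem _ _ x.2)]
    · simp [M.proj_ne x.2 h, N.proj_ne (f.map_mem _ _ x.2) h]
  exact LinearMap.congr_fun this m

theorem isInternal_sub (M : GrMod.{u, v, w} 𝓐) (K : Submodule Aᵐᵒᵖ M.carrier)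
    (hK : M.IsGradedSub K) :
    DirectSum.IsInternal fun i => (M.gr i).comap (K.subtype.restrictScalars k) := by
  let π : ℤ → K →ₗ[k] K := fun i =>
    { toFun := fun x => ⟨M.proj i x, hK x x.2 i⟩
      map_add' := fun x y => Subtype.ext (map_add (M.proj i) (x : M.carrier) y)
      map_smul' := fun c x => Subtype.ext (map_smul (M.proj i) c (x : M.carrier)) }
  refine isInternal_of_proj _ π (fun i x hx => Subtype.ext (M.proj_same hx))
    (fun i j hij x hx => Subtype.ext (M.proj_ne hx hij)) ?_
  classical
  rw [eq_top_iff]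
  rintro ⟨x, hx⟩ -
  have h : (⟨x, hx⟩ : K) = ∑ i ∈ (DirectSum.decompose M.gr x).support,
      (⟨M.proj i x, hK x hx i⟩ : K) := by
    apply Subtype.ext
    rw [AddSubmonoidClass.coe_finsetSum]
    exact (DirectSum.sum_support_decompose M.gr x).symm
  rw [h]
  exact Submodule.sum_mem _ fun i _ => Submodule.mem_iSup_of_mem i (M.proj_mem i x)

/-- A graded submodule `K` of `M`, as a graded module with components `K ∩ M_i`. -/
def sub (M : GrMod.{u, v, w} 𝓐) (K : Submodule Aᵐᵒᵖ M.carrier) (hK : M.IsGradedSub K) :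
    GrMod.{u, v, w} 𝓐 where
  carrier := K
  gr i := (M.gr i).comap (K.subtype.restrictScalars k)
  dec := (M.isInternal_sub K hK).chooseDecomposition
  smul_mem hm ha := M.smul_mem hm ha

theorem isInternal_quot (M : GrMod.{u, v, w} 𝓐) (K : Submodule Aᵐᵒᵖ M.carrier)
    (hK : M.IsGradedSub K) :
    DirectSum.IsInternal fun i => (M.gr i).map (K.mkQ.restrictScalars k) := by
  let π' : ℤ → M.carrier ⧸ K →+ M.carrier ⧸ K := fun i =>
    QuotientAddGroup.map _ _ (M.proj i).toAddMonoidHom fun m hm => hK m hm i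
  let π : ℤ → M.carrier ⧸ K →ₗ[k] M.carrier ⧸ K := fun i =>
    { toFun := π' i
      map_add' := map_add (π' i)
      map_smul' := fun c x => by
        obtain ⟨x, rfl⟩ := K.mkQ_surjective x
        exact congrArg K.mkQ (map_smul (M.proj i) c x) }
  refine isInternal_of_proj _ π ?_ ?_ ?_
  · rintro i _ ⟨m, hm, rfl⟩
    exact congrArg K.mkQ (M.proj_same hm)
  · rintro i j hij _ ⟨m, hm, rfl⟩
    exact (congrArg K.mkQ (M.proj_ne hm hij)).trans (map_zero _)
  · rw [← Submodule.map_iSup, M.iSup_gr, Submodule.map_top, LinearMap.range_eq_top]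
    exact K.mkQ_surjective

/-- The quotient of a graded module `M` by a graded submodule `K`; its components are the images
of the `M_i`. -/
def quot (M : GrMod.{u, v, w} 𝓐) (K : Submodule Aᵐᵒᵖ M.carrier) (hK : M.IsGradedSub K) :
    GrMod.{u, v, w} 𝓐 where
  carrier := M.carrier ⧸ K
  gr i := (M.gr i).map (K.mkQ.restrictScalars k)
  dec := (M.isInternal_quot K hK).chooseDecomposition
  smul_mem := by
    rintro i n _ a ⟨m, hm, rfl⟩ ha
    exact ⟨op a • m, M.smul_mem hm ha, rfl⟩

/-- The kernel of a morphism. -/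
def ker {M N : GrMod.{u, v, w} 𝓐} (f : M ⟶ N) : GrMod.{u, v, w} 𝓐 :=
  M.sub (LinearMap.ker f.lin) fun m hm i => by
    rw [LinearMap.mem_ker] at hm ⊢
    rw [Hom.proj_comm, hm, map_zero]

/-- The cokernel of a morphism. -/
def coker {M N : GrMod.{u, v, w} 𝓐} (f : M ⟶ N) : GrMod.{u, v, w} 𝓐 :=
  N.quot (LinearMap.range f.lin) fun _ hm i => by
    obtain ⟨m, rfl⟩ := hm
    exact ⟨M.proj i m, Hom.proj_comm f i m⟩

variable (𝓐) in
/-- The graded modules that are the sum of their finite-dimensional (graded) submodules. -/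
def Fdim : ObjectProperty (GrMod.{u, v, w} 𝓐) := fun M =>
  sSup {K : Submodule Aᵐᵒᵖ M.carrier | M.IsGradedSub K ∧ Module.Finite k K} = ⊤

/-- Localizing subcategories of the category of graded modules: closed under subobjects,
quotients, extensions and arbitrary direct sums, and containing `0`. -/
structure IsLocalizing (T : ObjectProperty (GrMod.{u, v, w} 𝓐)) : Prop where
  zero : T.ContainsZero
  sub : T.IsClosedUnderSubobjects
  quot : T.IsClosedUnderQuotients
  ext : T.IsClosedUnderExtensions
  coprod : ∀ J : Type w, T.IsClosedUnderColimitsOfShape (Discrete J)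

/-- The morphisms whose kernel and cokernel lie in `T`. -/
def isoMod (T : ObjectProperty (GrMod.{u, v, w} 𝓐)) : MorphismProperty (GrMod.{u, v, w} 𝓐) :=
  fun _ _ f => T (ker f) ∧ T (coker f)

/-- The quotient category of the category of graded modules by a Serre subcategory `T`: the
localization at the morphisms whose kernel and cokernel lie in `T`. -/
abbrev QuotCat (T : ObjectProperty (GrMod.{u, v, w} 𝓐)) := (isoMod T).Localization

/-- The canonical quotient functor. -/
abbrev toQuot (T : ObjectProperty (GrMod.{u, v, w} 𝓐)) : GrMod.{u, v, w} 𝓐 ⥤ QuotCat T :=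
  (isoMod T).Q

variable (𝓐) in
/-- The category `QGr A`. -/
abbrev QGr := QuotCat (Fdim.{u, v, w} 𝓐)

section ChangeOfRings

variable {B : Type v'} [Ring B] [Algebra k B] {ℬ : ℕ → Submodule k B}
  (φ : A →ₐ[k] B) (hφ : ∀ n, ∀ a ∈ 𝓐 n, φ a ∈ ℬ n)

/-- Restriction of graded modules along a homomorphism of graded algebras `φ : A → B`, with
`m · a = m · φ a`. -/
def restrict (N : GrMod.{u, v', w} ℬ) : GrMod.{u, v, w} 𝓐 where
  carrier := N.carrier
  moduleRight := Module.compHom N.carrier (AlgHom.op φ : Aᵐᵒᵖ →ₐ[k] Bᵐᵒᵖ).toRingHom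
  tower := letI := Module.compHom N.carrier (AlgHom.op φ : Aᵐᵒᵖ →ₐ[k] Bᵐᵒᵖ).toRingHom
    ⟨fun c a m => by
      change (AlgHom.op φ (c • a)) • m = c • (AlgHom.op φ a • m)
      rw [map_smul, smul_assoc]⟩
  gr := N.gr
  smul_mem hm ha := N.smul_mem hm (hφ _ _ ha)

/-- The graded `B`-modules whose restriction to `A` lies in `Fdim A`. -/
def restrictFdim : ObjectProperty (GrMod.{u, v', w} ℬ) :=
  fun N => Fdim.{u, v, w} 𝓐 (restrict φ hφ N)

/-- The relations `b ⊗ m a = φ(a) b ⊗ m` defining the tensor product over `A`.  The factor `B` is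
written on the left since Mathlib lets `Bᵐᵒᵖ` act on the left factor of a tensor product. -/
def tensorRel (M : GrMod.{u, v, w} 𝓐) : Submodule Bᵐᵒᵖ (B ⊗[k] M.carrier) :=
  Submodule.span Bᵐᵒᵖ
    {x | ∃ (b : B) (m : M.carrier) (a : A), x = b ⊗ₜ[k] (op a • m) - (φ a * b) ⊗ₜ[k] m}

/-- The right `B`-module `M ⊗_A B`. -/
abbrev Tensor (M : GrMod.{u, v, w} 𝓐) := (B ⊗[k] M.carrier) ⧸ tensorRel φ M

/-- The pure tensor `m ⊗ b` in `M ⊗_A B`. -/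
def pure (M : GrMod.{u, v, w} 𝓐) (m : M.carrier) (b : B) : Tensor φ M :=
  (tensorRel φ M).mkQ (b ⊗ₜ[k] m)

/-- The component of degree `d` of `M ⊗_A B`, spanned by the `m ⊗ b` with `m ∈ M_i`, `b ∈ B_n`
and `i + n = d`. -/
def tensorGr (ℬ : ℕ → Submodule k B) (M : GrMod.{u, v, w} 𝓐) (d : ℤ) :
    Submodule k (Tensor φ M) :=
  Submodule.span k {x | ∃ (i : ℤ) (n : ℕ) (m : M.carrier) (b : B),
    m ∈ M.gr i ∧ b ∈ ℬ n ∧ i + n = d ∧ x = pure φ M m b}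


theorem pure_rel (M : GrMod.{u, v, w} 𝓐) (m : M.carrier) (a : A) (b : B) :
    pure φ M (op a • m) b = pure φ M m (φ a * b) := by
  rw [← sub_eq_zero, pure, pure, ← map_sub]
  exact (Submodule.Quotient.mk_eq_zero _).2 (Submodule.subset_span ⟨b, m, a, rfl⟩)

theorem op_smul_pure (M : GrMod.{u, v, w} 𝓐) (m : M.carrier) (b c : B) :
    op c • pure φ M m b = pure φ M m (b * c) := rfl

/-- The bilinear map `(b, m) ↦ ∑ₙ m_{d-n} ⊗ b_n`. -/
def tensorProjAux (ℬ : ℕ → Submodule k B) [GradedAlgebra ℬ] (M : GrMod.{u, v, w} 𝓐) (d : ℤ) :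
    B →ₗ[k] M.carrier →ₗ[k] Tensor φ M :=
  (DirectSum.toModule k ℕ _ fun n =>
    ((((tensorRel φ M).mkQ.restrictScalars k).compRight k (M := M.carrier)) ∘ₗ
      (LinearMap.lcomp k _ (M.proj (d - n))) ∘ₗ
        (TensorProduct.mk k B M.carrier) ∘ₗ (ℬ n).subtype)) ∘ₗ
    (DirectSum.decomposeLinearEquiv ℬ).toLinearMap

theorem tensorProjAux_apply [GradedAlgebra ℬ] (M : GrMod.{u, v, w} 𝓐) (d : ℤ) (n : ℕ) (b : B) (hb : b ∈ ℬ n)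
    (m : M.carrier) : tensorProjAux φ ℬ M d b m = pure φ M (M.proj (d - n) m) b := by
  have : DirectSum.decomposeLinearEquiv ℬ b = DirectSum.lof k ℕ (fun n => ℬ n) n ⟨b, hb⟩ :=
    DirectSum.decomposeLinearEquiv_apply_coe ℬ n ⟨b, hb⟩
  simp [tensorProjAux, this, pure]

theorem tensorProjAux_rel [GradedAlgebra 𝓐] [GradedAlgebra ℬ]
    (hφ : ∀ n, ∀ a ∈ 𝓐 n, φ a ∈ ℬ n) (M : GrMod.{u, v, w} 𝓐) (d : ℤ)
    (a : A) (b : B) (m : M.carrier) :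
    tensorProjAux φ ℬ M d b (op a • m) = tensorProjAux φ ℬ M d (φ a * b) m := by
  induction a using DirectSum.Decomposition.inductionOn 𝓐 with
  | zero => simp
  | add a a' h h' => simp [add_smul, add_mul, h, h']
  | @homogeneous j a =>
    induction b using DirectSum.Decomposition.inductionOn ℬ with
    | zero => simp
    | add b b' h h' => simp [mul_add, h, h']
    | @homogeneous n b =>
      rw [tensorProjAux_apply φ M d n _ b.2, tensorProjAux_apply φ M d (j + n) _
        (SetLike.mul_mem_graded (hφ _ _ a.2) b.2), M.proj_smul a.2, pure_rel]
      congr 2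
      push_cast
      rw [sub_sub, add_comm (n : ℤ)]

/-- The projection of `M ⊗_A B` to its component of degree `d`. -/
def tensorProj [GradedAlgebra 𝓐] [GradedAlgebra ℬ] (M : GrMod.{u, v, w} 𝓐) (d : ℤ) :
    Tensor φ M →ₗ[k] Tensor φ M :=
  let L := TensorProduct.lift (tensorProjAux φ ℬ M d)
  have hL : ∀ x ∈ tensorRel φ M, L x = 0 := by
    intro x hx
    suffices h : ∀ c : Bᵐᵒᵖ, L (c • x) = 0 by simpa using h 1
    induction hx using Submodule.span_induction with
    | mem x hx =>
      obtain ⟨b, m, a, rfl⟩ := hx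
      intro c
      rw [smul_sub, map_sub, sub_eq_zero, TensorProduct.smul_tmul', TensorProduct.smul_tmul']
      simp only [L, TensorProduct.lift.tmul]
      rw [tensorProjAux_rel φ hφ]
      simp [mul_assoc]
    | zero => simp
    | add x y _ _ hx hy => intro c; rw [smul_add, map_add, hx, hy, add_zero]
    | smul r x _ hx => intro c; rw [smul_smul]; exact hx _
  let L' : Tensor φ M →+ Tensor φ M :=
    QuotientAddGroup.lift (tensorRel φ M).toAddSubgroup L.toAddMonoidHom hL
  { toFun := L'
    map_add' := map_add L'
    map_smul' := fun c x => by
      obtain ⟨x, rfl⟩ := (tensorRel φ M).mkQ_surjective x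
      exact map_smul L c x }

theorem tensorProj_pure [GradedAlgebra 𝓐] [GradedAlgebra ℬ] (M : GrMod.{u, v, w} 𝓐) (d : ℤ)
    (n : ℕ) (b : B) (hb : b ∈ ℬ n) (m : M.carrier) :
    tensorProj φ hφ M d (pure φ M m b) = pure φ M (M.proj (d - n) m) b :=
  (TensorProduct.lift.tmul (f' := tensorProjAux φ ℬ M d) b m).trans
    (tensorProjAux_apply φ M d n b hb m)

theorem isInternal_tensorGr [GradedAlgebra 𝓐] [GradedAlgebra ℬ]
    (hφ : ∀ n, ∀ a ∈ 𝓐 n, φ a ∈ ℬ n) (M : GrMod.{u, v, w} 𝓐) :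
    DirectSum.IsInternal (tensorGr φ ℬ M) := by
  refine isInternal_of_proj _ (tensorProj φ hφ M) ?_ ?_ ?_
  · intro d x hx
    induction hx using Submodule.span_induction with
    | mem x hx =>
      obtain ⟨i, n, m, b, hm, hb, rfl, rfl⟩ := hx
      rw [tensorProj_pure φ hφ M _ n b hb, add_sub_cancel_right, M.proj_same hm]
    | zero => simp
    | add x y _ _ hx hy => rw [map_add, hx, hy]
    | smul r x _ hx => rw [map_smul, hx]
  · intro d e hde x hx
    induction hx using Submodule.span_induction with
    | mem x hx =>
      obtain ⟨i, n, m, b, hm, hb, rfl, rfl⟩ := hx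
      rw [tensorProj_pure φ hφ M _ n b hb, M.proj_ne hm (by omega), pure,
        TensorProduct.tmul_zero, map_zero]
    | zero => simp
    | add x y _ _ hx hy => rw [map_add, hx, hy, add_zero]
    | smul r x _ hx => rw [map_smul, hx, smul_zero]
  · rw [eq_top_iff]
    rintro x -
    obtain ⟨x, rfl⟩ := (tensorRel φ M).mkQ_surjective x
    induction x with
    | zero => rw [map_zero]; exact zero_mem _
    | add x y hx hy => rw [map_add]; exact add_mem hx hy
    | tmul b m =>
      induction b using DirectSum.Decomposition.inductionOn ℬ with
      | zero => rw [TensorProduct.zero_tmul, map_zero]; exact zero_mem _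
      | add b b' h h' => rw [TensorProduct.add_tmul, map_add]; exact add_mem h h'
      | @homogeneous n b =>
        induction m using DirectSum.Decomposition.inductionOn M.gr with
        | zero => rw [TensorProduct.tmul_zero, map_zero]; exact zero_mem _
        | add b b' h h' => rw [TensorProduct.tmul_add, map_add]; exact add_mem h h'
        | @homogeneous i m =>
          exact Submodule.mem_iSup_of_mem (i + n : ℤ)
            (Submodule.subset_span ⟨i, n, m, b, m.2, b.2, rfl, rfl⟩)

/-- The map `f ⊗ 1` on the level of modules: `m ⊗ b ↦ f m ⊗ b`. -/
def tensorMapLin {M N : GrMod.{u, v, max v' w} 𝓐} (f : M ⟶ N) : Tensor φ M →ₗ[Bᵐᵒᵖ] Tensor φ N :=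
  (tensorRel φ M).mapQ (tensorRel φ N)
    (TensorProduct.AlgebraTensorModule.map (LinearMap.id : B →ₗ[Bᵐᵒᵖ] B) (f.lin.restrictScalars k))
    (Submodule.span_le.2 (by
      rintro _ ⟨b, m, a, rfl⟩
      exact Submodule.subset_span ⟨b, f.lin m, a, by simp⟩))

theorem tensorMapLin_pure {M N : GrMod.{u, v, max v' w} 𝓐} (f : M ⟶ N) (m : M.carrier) (b : B) :
    tensorMapLin φ f (pure φ M m b) = pure φ N (f.lin m) b := rfl

theorem tensor_hom_ext {M : GrMod.{u, v, max v' w} 𝓐} {P : Type*} [AddCommGroup P] [Module Bᵐᵒᵖ P]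
    {f g : Tensor φ M →ₗ[Bᵐᵒᵖ] P} (h : ∀ m b, f (pure φ M m b) = g (pure φ M m b)) : f = g := by
  refine LinearMap.ext fun x => ?_
  obtain ⟨x, rfl⟩ := (tensorRel φ M).mkQ_surjective x
  induction x with
  | zero => simp
  | add x y hx hy => rw [map_add, map_add, map_add, hx, hy]
  | tmul b m => exact h m b

theorem tensorMapLin_mem {M N : GrMod.{u, v, max v' w} 𝓐} (f : M ⟶ N) (d : ℤ)
    (x : Tensor φ M) (hx : x ∈ tensorGr φ ℬ M d) : tensorMapLin φ f x ∈ tensorGr φ ℬ N d := by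
  induction hx using Submodule.span_induction with
  | mem x hx =>
    obtain ⟨i, j, m, b, hm, hb, rfl, rfl⟩ := hx
    exact Submodule.subset_span ⟨i, j, f.lin m, b, f.map_mem _ _ hm, hb, rfl, rfl⟩
  | zero => rw [map_zero]; exact zero_mem _
  | add x y _ _ hx hy => rw [map_add]; exact add_mem hx hy
  | smul r x _ hx =>
    have := ((tensorMapLin φ f).restrictScalars k).map_smul r x
    exact this ▸ Submodule.smul_mem _ _ hx

end ChangeOfRings

section Functors

variable {B : Type v'} [Ring B] [Algebra k B] {ℬ : ℕ → Submodule k B}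
  [GradedAlgebra 𝓐] [GradedAlgebra ℬ]
  (φ : A →ₐ[k] B) (hφ : ∀ n, ∀ a ∈ 𝓐 n, φ a ∈ ℬ n)

/-- The graded right `B`-module `M ⊗_A B`. -/
def tensor (M : GrMod.{u, v, max v' w} 𝓐) : GrMod.{u, v', max v' w} ℬ where
  carrier := Tensor φ M
  gr := tensorGr φ ℬ M
  dec := (isInternal_tensorGr φ hφ M).chooseDecomposition
  smul_mem := by
    intro d n x c hx hc
    induction hx using Submodule.span_induction with
    | mem x hx =>
      obtain ⟨i, j, m, b, hm, hb, rfl, rfl⟩ := hx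
      rw [op_smul_pure]
      exact Submodule.subset_span ⟨i, j + n, m, b * c, hm, SetLike.mul_mem_graded hb hc,
        by push_cast; ring, rfl⟩
    | zero => rw [smul_zero]; exact zero_mem _
    | add x y _ _ hx hy => rw [smul_add]; exact add_mem hx hy
    | smul r x _ hx => rw [smul_comm]; exact Submodule.smul_mem _ _ hx

/-- The functor `- ⊗_A B : Gr A ⥤ Gr B`. -/
def tensorFunctor : GrMod.{u, v, max v' w} 𝓐 ⥤ GrMod.{u, v', max v' w} ℬ where
  obj M := tensor φ hφ M
  map f := ⟨tensorMapLin φ f, fun d x hx => tensorMapLin_mem φ f d x hx⟩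
  map_id _ := Hom.ext (tensor_hom_ext φ fun _ _ => rfl)
  map_comp _ _ := Hom.ext (tensor_hom_ext φ fun _ _ => rfl)
end Functors
end GrMod
end GradedModules
section PathAlgebra

variable (k : Type u) [Field k] (V : Type v) [Quiver.{v'} V]

/-- The type of all paths of a quiver, including the trivial paths at the vertices. -/
abbrev AnyPath := Σ (a : V) (b : V), Quiver.Path a b

/-- The path algebra of a quiver: the vector space with basis the set of all paths. -/
def PathAlgebra := AnyPath V →₀ k

namespace PathAlgebra

instance : AddCommGroup (PathAlgebra k V) := inferInstanceAs (AddCommGroup (AnyPath V →₀ k))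

instance : Module k (PathAlgebra k V) := inferInstanceAs (Module k (AnyPath V →₀ k))

variable {V}

/-- The basis vector of the path algebra given by a path. -/
def ofPath {a b : V} (p : Quiver.Path a b) : PathAlgebra k V :=
  Finsupp.single (⟨a, b, p⟩ : AnyPath V) 1

variable {k} in
theorem hom_ext {M : Type*} [AddCommGroup M] [Module k M] {f g : PathAlgebra k V →ₗ[k] M}
    (h : ∀ (a b : V) (p : Quiver.Path a b), f (ofPath k p) = g (ofPath k p)) : f = g :=
  Finsupp.lhom_ext' fun p => LinearMap.ext_ring (h p.1 p.2.1 p.2.2)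

open Classical in
/-- The product of two paths: "first `p`, then `q`" if `p` ends where `q` starts, and `0`
otherwise. -/
def pathMul {a b c d : V} (p : Quiver.Path a b) (q : Quiver.Path c d) : PathAlgebra k V :=
  if h : b = c then ofPath k (p.comp (q.cast h.symm rfl)) else 0

variable (V) in
/-- The bilinear extension of the product of paths. -/
def mulLin : PathAlgebra k V →ₗ[k] PathAlgebra k V →ₗ[k] PathAlgebra k V :=
  Finsupp.linearCombination k fun p : AnyPath V =>
    (Finsupp.linearCombination k fun q : AnyPath V => pathMul k p.2.2 q.2.2 :
      (AnyPath V →₀ k) →ₗ[k] PathAlgebra k V)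

instance : Mul (PathAlgebra k V) := ⟨fun x y => mulLin k V x y⟩

theorem mul_def (x y : PathAlgebra k V) : x * y = mulLin k V x y := rfl

theorem ofPath_mul_ofPath {a b c d : V} (p : Quiver.Path a b) (q : Quiver.Path c d) :
    ofPath k p * ofPath k q = pathMul k p q := by
  rw [mul_def, mulLin, ofPath, ofPath]
  erw [Finsupp.linearCombination_single, one_smul, Finsupp.linearCombination_single, one_smul]

theorem ofPath_mul_comp {a b c : V} (p : Quiver.Path a b) (q : Quiver.Path b c) :
    ofPath k p * ofPath k q = ofPath k (p.comp q) := by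
  rw [ofPath_mul_ofPath, pathMul, dif_pos rfl, Quiver.Path.cast_rfl_rfl]

theorem ofPath_mul_of_ne {a b c d : V} (p : Quiver.Path a b) (q : Quiver.Path c d) (h : b ≠ c) :
    ofPath k p * ofPath k q = 0 := by
  rw [ofPath_mul_ofPath, pathMul, dif_neg h]

variable {k} in
@[elab_as_elim]
theorem path_induction {P : PathAlgebra k V → Prop} (x : PathAlgebra k V) (zero : P 0)
    (add : ∀ x y, P x → P y → P (x + y)) (smul : ∀ (c : k) (x), P x → P (c • x))
    (path : ∀ (a b : V) (p : Quiver.Path a b), P (ofPath k p)) : P x := by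
  refine Finsupp.induction_linear (motive := P) x zero add fun p c => ?_
  rw [← Finsupp.smul_single_one]
  exact smul c _ (path p.1 p.2.1 p.2.2)

theorem smul_mul (c : k) (x y : PathAlgebra k V) : (c • x) * y = c • (x * y) :=
  LinearMap.map_smul₂ (mulLin k V) c x y

theorem mul_smul' (c : k) (x y : PathAlgebra k V) : x * (c • y) = c • (x * y) :=
  map_smul (mulLin k V x) c y

instance : NonUnitalNonAssocRing (PathAlgebra k V) where
  left_distrib x y z := map_add (mulLin k V x) y z
  right_distrib x y z := LinearMap.map_add₂ (mulLin k V) x y z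
  zero_mul x := LinearMap.map_zero₂ (mulLin k V) x
  mul_zero x := map_zero (mulLin k V x)

theorem mul_assoc' (x y z : PathAlgebra k V) : x * y * z = x * (y * z) := by
  induction x using path_induction with
  | zero => simp
  | add x x' h h' => simp [add_mul, h, h']
  | smul c x h => simp [smul_mul, h]
  | path a b p =>
  induction y using path_induction with
  | zero => simp
  | add x x' h h' => simp [add_mul, mul_add, h, h']
  | smul c x h => simp [smul_mul, mul_smul', h]
  | path c d q =>
  induction z using path_induction with
  | zero => simp
  | add x x' h h' => simp [mul_add, h, h']
  | smul c x h => simp [mul_smul', h]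
  | path e f r =>
  by_cases h : b = c
  · subst h
    by_cases h' : d = e
    · subst h'
      simp only [ofPath_mul_comp, Quiver.Path.comp_assoc]
    · rw [ofPath_mul_comp, ofPath_mul_of_ne _ _ _ h', ofPath_mul_of_ne _ _ _ h', mul_zero]
  · rw [ofPath_mul_of_ne _ _ _ h, zero_mul]
    by_cases h' : d = e
    · subst h'
      rw [ofPath_mul_comp, ofPath_mul_of_ne _ _ _ h]
    · rw [ofPath_mul_of_ne _ _ _ h', mul_zero]

section Unital

variable [Fintype V]

/-- The unit is the sum of the trivial paths. -/
instance : One (PathAlgebra k V) := ⟨∑ a : V, ofPath k (Quiver.Path.nil : Quiver.Path a a)⟩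

theorem one_def : (1 : PathAlgebra k V) =
    ∑ a : V, ofPath k (Quiver.Path.nil : Quiver.Path a a) := rfl

theorem one_mul' (x : PathAlgebra k V) : 1 * x = x := by
  induction x using path_induction with
  | zero => exact mul_zero _
  | add x x' h h' => rw [mul_add, h, h']
  | smul c x h => rw [mul_smul', h]
  | path a b p =>
    rw [one_def, Finset.sum_mul, Finset.sum_eq_single a]
    · rw [ofPath_mul_comp, Quiver.Path.nil_comp]
    · intro c _ hc; exact ofPath_mul_of_ne _ _ _ hc
    · simp

theorem mul_one' (x : PathAlgebra k V) : x * 1 = x := by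
  induction x using path_induction with
  | zero => exact zero_mul _
  | add x x' h h' => rw [add_mul, h, h']
  | smul c x h => rw [smul_mul, h]
  | path a b p =>
    rw [one_def, Finset.mul_sum, Finset.sum_eq_single b]
    · rw [ofPath_mul_comp, Quiver.Path.comp_nil]
    · intro c _ hc; exact ofPath_mul_of_ne _ _ _ hc.symm
    · simp

instance : Ring (PathAlgebra k V) :=
  { (inferInstance : NonUnitalNonAssocRing (PathAlgebra k V)) with
    mul_assoc := mul_assoc' k
    one_mul := one_mul' k
    mul_one := mul_one' k }

instance : Algebra k (PathAlgebra k V) := Algebra.ofModule (smul_mul k) (mul_smul' k)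

end Unital

/-- The degree of a path: the sum of the degrees of its arrows. -/
def pathDeg (wt : ∀ a b : V, (a ⟶ b) → ℕ) {a b : V} (p : Quiver.Path a b) : ℕ :=
  p.addWeight fun {a b} e => wt a b e

/-- The component of degree `n` of the weighted path algebra in which each arrow `e` has degree
`wt e`: the span of the paths of degree `n`. -/
def gr (wt : ∀ a b : V, (a ⟶ b) → ℕ) (n : ℕ) : Submodule k (PathAlgebra k V) :=
  Submodule.span k {x | ∃ (a b : V) (p : Quiver.Path a b), pathDeg wt p = n ∧ x = ofPath k p}

variable (wt : ∀ a b : V, (a ⟶ b) → ℕ)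

theorem isInternal_gr : DirectSum.IsInternal (gr k wt) := by
  classical
  let π : ℕ → PathAlgebra k V →ₗ[k] PathAlgebra k V := fun n =>
    (Finsupp.linearCombination k fun p : AnyPath V =>
      if pathDeg wt p.2.2 = n then ofPath k p.2.2 else 0 : (AnyPath V →₀ k) →ₗ[k] _)
  have hπ : ∀ n (a b : V) (p : Quiver.Path a b),
      π n (ofPath k p) = if pathDeg wt p = n then ofPath k p else 0 := by
    intro n a b p
    simp only [π]
    rw [ofPath]
    erw [Finsupp.linearCombination_single, one_smul]
    rfl
  refine isInternal_of_proj _ π ?_ ?_ ?_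
  · intro n x hx
    change x ∈ LinearMap.eqLocus (π n) LinearMap.id
    refine (Submodule.span_le.2 ?_ : gr k wt n ≤ _) hx
    rintro _ ⟨a, b, p, rfl, rfl⟩
    simp [hπ]
  · intro n m hnm x hx
    change x ∈ LinearMap.ker (π m)
    refine (Submodule.span_le.2 ?_ : gr k wt n ≤ _) hx
    rintro _ ⟨a, b, p, rfl, rfl⟩
    simp [hπ, hnm]
  · rw [eq_top_iff]
    rintro x -
    exact path_induction x (zero_mem _) (fun _ _ h h' => add_mem h h')
      (fun c _ h => Submodule.smul_mem _ c h) fun a b p =>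
        Submodule.mem_iSup_of_mem (pathDeg wt p) (Submodule.subset_span ⟨a, b, p, rfl, rfl⟩)

instance [Fintype V] : GradedAlgebra (gr k wt) where
  one_mem := by
    rw [one_def]
    exact Submodule.sum_mem _ fun a _ => Submodule.subset_span ⟨a, a, _, by simp [pathDeg], rfl⟩
  mul_mem := by
    intro i j x y hx hy
    have := Submodule.mul_mem_mul hx hy
    rw [gr, gr, Submodule.span_mul_span] at this
    refine (Submodule.span_le.2 ?_) this
    rintro _ ⟨_, ⟨a, b, p, rfl, rfl⟩, _, ⟨c, d, q, rfl, rfl⟩, rfl⟩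
    dsimp only
    by_cases h : b = c
    · subst h
      rw [ofPath_mul_comp]
      exact Submodule.subset_span ⟨_, _, _, Quiver.Path.addWeight_comp _ _ _, rfl⟩
    · rw [ofPath_mul_of_ne _ _ _ h]
      exact zero_mem _
  toDecomposition := (isInternal_gr k wt).chooseDecomposition

end PathAlgebra
end PathAlgebra

section Monomial

variable (k : Type u) [Field k] {G : Type v}

/-- A word in the letters `G`, as an element of the free algebra `k⟨G⟩`. -/
def word (w : List G) : FreeAlgebra k G := (w.map (FreeAlgebra.ι k)).prod

/-- The relations `w = 0` for `w ∈ F`. -/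
inductive MonomialRel (F : Finset (List G)) : FreeAlgebra k G → FreeAlgebra k G → Prop
  | of (w : List G) (hw : w ∈ F) : MonomialRel F (word k w) 0

/-- The monomial algebra `k⟨G⟩/(F)`, the quotient of the free algebra by the two-sided ideal
generated by the words in `F`. -/
abbrev MonomialAlgebra (F : Finset (List G)) := RingQuot (MonomialRel k F)

namespace MonomialAlgebra

variable (F : Finset (List G))

/-- The class of a word in `k⟨G⟩/(F)`. -/
def mkWord (w : List G) : MonomialAlgebra k F := RingQuot.mkAlgHom k (MonomialRel k F) (word k w)

/-- The degree of a word: the sum of the degrees of its letters. -/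
def wordDeg (deg : G → ℕ) (w : List G) : ℕ := (w.map deg).sum

/-- The component of degree `n` of the monomial algebra in which each letter `x` has degree
`deg x`. -/
def gr (deg : G → ℕ) (n : ℕ) : Submodule k (MonomialAlgebra k F) :=
  Submodule.span k {x | ∃ w : List G, wordDeg deg w = n ∧ x = mkWord k F w}

theorem mkWord_nil : mkWord k F [] = 1 := by simp [mkWord, word]

theorem mkWord_append (w w' : List G) : mkWord k F (w ++ w') = mkWord k F w * mkWord k F w' := by
  simp [mkWord, word]

theorem mkWord_eq_zero {w : List G} (hw : w ∈ F) : mkWord k F w = 0 := by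
  rw [mkWord, RingQuot.mkAlgHom_rel k (MonomialRel.of w hw), map_zero]

instance (deg : G → ℕ) : SetLike.GradedMonoid (gr k F deg) where
  one_mem := Submodule.subset_span ⟨[], rfl, (mkWord_nil k F).symm⟩
  mul_mem := by
    intro i j x y hx hy
    have := Submodule.mul_mem_mul hx hy
    rw [gr, gr, Submodule.span_mul_span] at this
    refine (Submodule.span_le.2 ?_) this
    rintro _ ⟨_, ⟨w, rfl, rfl⟩, _, ⟨w', rfl, rfl⟩, rfl⟩
    exact Submodule.subset_span ⟨w ++ w', by simp [wordDeg], (mkWord_append k F w w').symm⟩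

/-- The class of a word, as a homogeneous element. -/
def homWord (deg : G → ℕ) (w : List G) : gr k F deg (wordDeg deg w) :=
  ⟨mkWord k F w, Submodule.subset_span ⟨w, rfl, rfl⟩⟩

theorem lift_word (deg : G → ℕ) (w : List G) :
    FreeAlgebra.lift k (fun x => DirectSum.of (fun n => gr k F deg n) _ (homWord k F deg [x]))
      (word k w) = DirectSum.of (fun n => gr k F deg n) _ (homWord k F deg w) := by
  induction w with
  | nil =>
    simp only [word, List.map_nil, List.prod_nil, map_one]
    rw [DirectSum.one_def]
    exact DirectSum.of_eq_of_gradedMonoid_eq (Sigma.subtype_ext rfl (mkWord_nil k F).symm)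
  | cons x w ih =>
    have : word k (x :: w) = FreeAlgebra.ι k x * word k w := by simp [word]
    rw [this, map_mul, ih, FreeAlgebra.lift_ι_apply, DirectSum.of_mul_of]
    refine DirectSum.of_eq_of_gradedMonoid_eq (Sigma.subtype_ext ?_ ?_)
    · change wordDeg deg [x] + wordDeg deg w = wordDeg deg (x :: w)
      simp [wordDeg]
    · exact (mkWord_append k F [x] w).symm

/-- The decomposition into homogeneous components, as a homomorphism of algebras. -/
def decomposeHom (deg : G → ℕ) : MonomialAlgebra k F →ₐ[k] ⨁ n, gr k F deg n :=
  RingQuot.liftAlgHom k ⟨FreeAlgebra.lift k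
    (fun x => DirectSum.of (fun n => gr k F deg n) _ (homWord k F deg [x])), by
      rintro _ _ ⟨w, hw⟩
      rw [lift_word, map_zero]
      have : homWord k F deg w = 0 := Subtype.ext (mkWord_eq_zero k F hw)
      rw [this, map_zero]⟩

theorem decomposeHom_mkWord (deg : G → ℕ) (w : List G) :
    decomposeHom k F deg (mkWord k F w) =
      DirectSum.of (fun n => gr k F deg n) _ (homWord k F deg w) := by
  rw [decomposeHom, mkWord, RingQuot.liftAlgHom_mkAlgHom_apply, lift_word]

instance (deg : G → ℕ) : GradedAlgebra (gr k F deg) :=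
  GradedAlgebra.ofAlgHom _ (decomposeHom k F deg)
    (by
      apply RingQuot.ringQuot_ext'
      apply FreeAlgebra.hom_ext
      funext x
      simp [decomposeHom, homWord, mkWord, word])
    (by
      rintro i ⟨x, hx⟩
      change decomposeHom k F deg x = DirectSum.lof k ℕ (fun n => gr k F deg n) i ⟨x, hx⟩
      induction hx using Submodule.span_induction with
      | mem x hx =>
        obtain ⟨w, rfl, rfl⟩ := hx
        exact decomposeHom_mkWord k F deg w
      | zero =>
        rw [map_zero]
        exact (map_zero (DirectSum.lof k ℕ (fun n => gr k F deg n) i)).symm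
      | add x y hx' hy' hx hy =>
        rw [map_add, hx, hy]
        exact (map_add (DirectSum.lof k ℕ (fun n => gr k F deg n) i) ⟨x, hx'⟩ ⟨y, hy'⟩).symm
      | smul c x hx' hx =>
        rw [map_smul, hx]
        exact (map_smul (DirectSum.lof k ℕ (fun n => gr k F deg n) i) c ⟨x, hx'⟩).symm)

end MonomialAlgebra
end Monomial

section Ufnarovskii

variable {G : Type v} (F : Finset (List G))

/-- A word is legal if it does not lie in the ideal generated by the forbidden words (the elements
of `F`): no forbidden word is a subword of it, i.e. it is not of the form `u ++ w ++ v`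
with `w ∈ F`. -/
def Legal (w : List G) : Prop := ∀ u ∈ F, ¬ u <:+: w

/-- The set `L_n` of legal words of length `n`. -/
@[ext]
structure LegalWord (n : ℕ) where
  /-- the underlying word -/
  word : List G
  legal : Legal F word
  length_eq : word.length = n

instance [Finite G] (n : ℕ) : Finite (LegalWord F n) :=
  have := (List.finite_length_eq G n).to_subtype
  Finite.of_injective (β := {w : List G | w.length = n}) (fun w => ⟨w.word, w.length_eq⟩)
    fun _ _ h => LegalWord.ext (congrArg Subtype.val h)

instance [Finite G] (n : ℕ) : Fintype (LegalWord F n) := Fintype.ofFinite _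

/-- The number `ℓ`: the maximal length of a forbidden word is `ℓ + 1`.  (`ℓ = 0` if there is no
forbidden word.) -/
def ell : ℕ := F.sup List.length - 1

theorem length_le_of_mem {u : List G} (hu : u ∈ F) : u.length ≤ ell F + 1 := by
  have : u.length ≤ F.sup List.length := Finset.le_sup hu
  unfold ell
  omega

/-- The vertices of the Ufnarovskii graph: the legal words of length `ℓ`. -/
abbrev UfVertex := LegalWord F (ell F)

/-- The arrows of the Ufnarovskii graph: the legal words of length `ℓ + 1`. -/
abbrev UfArrow := LegalWord F (ell F + 1)

variable {F}

theorem Legal.of_infix {w w' : List G} (h : Legal F w) (h' : w' <:+: w) : Legal F w' :=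
  fun u hu hw => h u hu (hw.trans h')

/-- The word `v` of length `ℓ` with `w = v ++ [y]` for a letter `y`. -/
def LegalWord.source (w : UfArrow F) : UfVertex F :=
  ⟨w.word.dropLast, w.legal.of_infix (List.dropLast_prefix _).isInfix, by simp [w.length_eq]⟩

/-- The word `u` of length `ℓ` with `w = x :: u` for a letter `x`. -/
def LegalWord.target (w : UfArrow F) : UfVertex F :=
  ⟨w.word.tail, w.legal.of_infix (List.tail_suffix _).isInfix, by simp [w.length_eq]⟩

/-- The label of an arrow: the first letter of the word. -/
def LegalWord.label (w : UfArrow F) : G :=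
  w.word.head (List.ne_nil_of_length_pos (by rw [w.length_eq]; omega))

/-- The Ufnarovskii graph. -/
instance : Quiver (UfVertex F) :=
  ⟨fun v u => {w : UfArrow F // w.source = v ∧ w.target = u}⟩

/-- A legal word of length `ℓ + 1`, as an arrow of the Ufnarovskii graph. -/
def LegalWord.arrow (w : UfArrow F) : w.source ⟶ w.target := ⟨w, rfl, rfl⟩

variable (F) in
/-- The degree of an arrow is the degree of its label. -/
def ufWeight (deg : G → ℕ) (v u : UfVertex F) (e : v ⟶ u) : ℕ := deg e.1.label

/-- The label of a path: the word formed by the labels of its arrows. -/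
def pathLabel : {v u : UfVertex F} → Quiver.Path v u → List G
  | _, _, .nil => []
  | _, _, .cons p e => pathLabel p ++ [e.1.label]

theorem pathLabel_comp {v u t : UfVertex F} (p : Quiver.Path v u) (q : Quiver.Path u t) :
    pathLabel (p.comp q) = pathLabel p ++ pathLabel q := by
  induction q with
  | nil => simp [pathLabel]
  | cons q e ih => simp [pathLabel, ih]

theorem legal_pathLabel_append {v u : UfVertex F} (p : Quiver.Path v u) :
    Legal F (pathLabel p ++ u.word) := by
  induction p with
  | nil => simpa [pathLabel] using v.legal
  | @cons u t p e ih =>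
    obtain ⟨w, rfl, rfl⟩ := e
    have hne : w.word ≠ [] := List.ne_nil_of_length_pos (by rw [w.length_eq]; omega)
    have h1 : pathLabel p ++ [w.label] ++ w.target.word = pathLabel p ++ w.word := by
      rw [List.append_assoc]
      congr 1
      exact List.cons_head_tail hne
    have h2 : pathLabel p ++ w.word = (pathLabel p ++ w.source.word) ++ [w.word.getLast hne] := by
      rw [List.append_assoc]
      congr 1
      exact (List.dropLast_append_getLast hne).symm
    have h3 : pathLabel (p.cons w.arrow) = pathLabel p ++ [w.label] := by
      simp [pathLabel, LegalWord.arrow]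
    change Legal F (pathLabel (p.cons w.arrow) ++ w.target.word)
    rw [h3, h1]
    intro f hf hfw
    rw [h2, List.infix_concat_iff] at hfw
    rcases hfw with hfw | hfw
    · rw [← h2] at hfw
      refine w.legal f hf (List.suffix_of_suffix_length_le hfw (List.suffix_append _ _) ?_).isInfix
      rw [w.length_eq]
      exact length_le_of_mem F hf
    · exact ih f hf hfw

end Ufnarovskii

section UfAlgebra

variable (k : Type u) [Field k] {G : Type v} [Finite G] (F : Finset (List G))

/-- The path algebra of the Ufnarovskii graph. -/
abbrev UfAlgebra := PathAlgebra k (UfVertex F)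

open Classical in
/-- The sum of all arrows with label `x`. -/
def labelSum (x : G) : UfAlgebra k F :=
  ∑ w : UfArrow F with w.label = x, PathAlgebra.ofPath k w.arrow.toPath

/-- The span of all paths with label `w`. -/
def labelSpan (w : List G) : Submodule k (UfAlgebra k F) :=
  Submodule.span k {x | ∃ (v u : UfVertex F) (p : Quiver.Path v u),
    pathLabel p = w ∧ x = PathAlgebra.ofPath k p}

theorem lift_word_mem (w : List G) :
    FreeAlgebra.lift k (labelSum k F) (word k w) ∈ labelSpan k F w := by
  induction w with
  | nil =>
    simp only [word, List.map_nil, List.prod_nil, map_one]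
    exact Submodule.sum_mem _ fun a _ => Submodule.subset_span ⟨a, a, _, by simp [pathLabel], rfl⟩
  | cons x w ih =>
    have hx : labelSum k F x ∈ labelSpan k F [x] := by
      classical
      refine Submodule.sum_mem _ fun e he => Submodule.subset_span ⟨_, _, _, ?_, rfl⟩
      have he' : e.label = x := by simpa using he
      simp [Quiver.Hom.toPath, pathLabel, LegalWord.arrow, he']
    have : word k (x :: w) = FreeAlgebra.ι k x * word k w := by simp [word]
    rw [this, map_mul, FreeAlgebra.lift_ι_apply]
    have := Submodule.mul_mem_mul hx ih
    rw [labelSpan, labelSpan, Submodule.span_mul_span] at this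
    refine (Submodule.span_le.2 ?_) this
    rintro _ ⟨_, ⟨a, b, p, hp, rfl⟩, _, ⟨c, d, q, hq, rfl⟩, rfl⟩
    dsimp only
    by_cases h : b = c
    · subst h
      rw [PathAlgebra.ofPath_mul_comp]
      exact Submodule.subset_span ⟨_, _, _, by rw [pathLabel_comp, hp, hq]; rfl, rfl⟩
    · rw [PathAlgebra.ofPath_mul_of_ne _ _ _ h]
      exact zero_mem _

/-- The homomorphism of algebras `f : A → kQ(A)` sending each letter `x` to the sum of all arrows
labelled `x`. -/
def ufHom : MonomialAlgebra k F →ₐ[k] UfAlgebra k F :=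
  RingQuot.liftAlgHom k ⟨FreeAlgebra.lift k (labelSum k F), by
    rintro _ _ ⟨w, hw⟩
    rw [map_zero, ← Submodule.mem_bot k]
    refine (Submodule.span_le.2 ?_ : labelSpan k F w ≤ ⊥) (lift_word_mem k F w)
    rintro _ ⟨v, u, p, rfl, rfl⟩
    exact (legal_pathLabel_append p _ hw (List.prefix_append _ _).isInfix).elim⟩

theorem ufHom_mkWord (w : List G) :
    ufHom k F (MonomialAlgebra.mkWord k F w) = FreeAlgebra.lift k (labelSum k F) (word k w) :=
  RingQuot.liftAlgHom_mkAlgHom_apply _ _ _ _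

theorem pathDeg_eq {G : Type v} (F : Finset (List G)) (deg : G → ℕ) {v u : UfVertex F} (p : Quiver.Path v u) :
    PathAlgebra.pathDeg (ufWeight F deg) p = MonomialAlgebra.wordDeg deg (pathLabel p) := by
  induction p with
  | nil => simp [PathAlgebra.pathDeg, MonomialAlgebra.wordDeg, pathLabel]
  | cons p e ih =>
    have h : PathAlgebra.pathDeg (ufWeight F deg) (p.cons e) =
        PathAlgebra.pathDeg (ufWeight F deg) p + deg e.1.label :=
      Quiver.Path.addWeight_cons _ p e
    rw [h, ih]
    simp [MonomialAlgebra.wordDeg, pathLabel]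

/-- The homomorphism `f` preserves degrees. -/
theorem ufHom_mem (deg : G → ℕ) (n : ℕ) (a : MonomialAlgebra k F)
    (ha : a ∈ MonomialAlgebra.gr k F deg n) :
    ufHom k F a ∈ PathAlgebra.gr k (ufWeight F deg) n := by
  change a ∈ (PathAlgebra.gr k (ufWeight F deg) n).comap (ufHom k F).toLinearMap
  refine (Submodule.span_le.2 ?_ : MonomialAlgebra.gr k F deg n ≤ _) ha
  rintro _ ⟨w, rfl, rfl⟩
  change ufHom k F (MonomialAlgebra.mkWord k F w) ∈ PathAlgebra.gr k (ufWeight F deg) _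
  rw [ufHom_mkWord]
  refine (Submodule.span_le.2 ?_ : labelSpan k F w ≤ _) (lift_word_mem k F w)
  rintro _ ⟨v, u, p, rfl, rfl⟩
  exact Submodule.subset_span ⟨v, u, p, pathDeg_eq F deg p, rfl⟩

end UfAlgebra

section Main

variable (k : Type u) [Field k] {G : Type v} [Finite G] (F : Finset (List G)) (deg : G → ℕ)

/-- The homogeneous components of the monomial algebra `A = k⟨G⟩/(F)`. -/
abbrev grA : ℕ → Submodule k (MonomialAlgebra k F) := MonomialAlgebra.gr k F deg

/-- The homogeneous components of the path algebra `kQ(A)` of the weighted Ufnarovskii graph. -/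
abbrev grKQ : ℕ → Submodule k (UfAlgebra k F) := PathAlgebra.gr k (ufWeight F deg)

/-- The subcategory `T_A` of the graded `kQ(A)`-modules whose restriction to `A` is in `Fdim A`. -/
abbrev TA : ObjectProperty (GrMod.{u, max u v, w} (grKQ k F deg)) :=
  GrMod.restrictFdim (𝓐 := grA k F deg) (ufHom k F) (ufHom_mem k F deg)

/-- The functor `- ⊗_A kQ(A) : Gr A ⥤ Gr kQ(A)`. -/
abbrev tensorKQ :
    GrMod.{u, max u v, max u v w} (grA k F deg) ⥤ GrMod.{u, max u v, max u v w} (grKQ k F deg) :=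
  GrMod.tensorFunctor.{u, max u v, max u v, w} (ufHom k F) (ufHom_mem k F deg)

end Main

end MonomialQGr

end

/-!
The ring homomorphism `f : A → kQ(A)` is an isomorphism up to finite-dimensional errors on the
right: words of length `ℓ` annihilate its kernel and its cokernel.  This is witnessed, for a word
`w` of length `ℓ`, by the linear map `s : kQ(A) → A` sending a path with label `t` to `t w` if it
ends at the vertex `w`, and to `0` otherwise (`wordSection`).  A path is determined by its label and
its endpoint, which together form a legal word beginning with the starting vertex; hence `s` is a
homomorphism of left `A`-modules with `s 1 = w`, and `f (s b) = b f(w)` (`hasWordSections_ufHom`).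

Call an element of a module torsion if it is killed by all words of some length.  As letters have
positive degree and there are finitely many of them, `Fdim A` is the class of graded modules all of
whose elements are torsion (`GrMod.Fdim_eq_torsion`), and `T_A` is described in the same way
(`TA_eq_torsion`).  Such classes are localizing (`GrMod.isLocalizing_torsion`), and the morphisms
inverted in the quotient categories are those that are bijective up to torsion, `IsAlmostIso`.

For a graded `A`-module `M` the unit `M → M ⊗_A kQ(A)` is bijective up to torsion
(`GrMod.isAlmostIso_unit`): the maps `m ⊗ b ↦ m · s b` show that words of length `ℓ` annihilate its
kernel, and `(m ⊗ b) · w = (m · s b) ⊗ 1` that they map the target into its image.  Since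
isomorphisms up to torsion can be cancelled, it follows formally, with no flatness of `kQ(A)`, that
`- ⊗_A kQ(A)` preserves them and that the counit is one.  So tensoring and restriction induce
mutually inverse equivalences (`GrMod.exists_equivalence_of_eq_torsion`).
-/

noncomputable section

namespace MonomialQGr

/-! ### Torsion elements and morphisms that are isomorphisms modulo torsion -/

section Torsion

variable {G A : Type*} [Ring A] (g : G → A)
  {M N P : Type*} [AddCommGroup M] [Module Aᵐᵒᵖ M] [AddCommGroup N] [Module Aᵐᵒᵖ N]
  [AddCommGroup P] [Module Aᵐᵒᵖ P]

/-- The right action on a module of the word `w` in the letters `g x`: the element `m · w`. -/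
def wordAct (w : List G) (m : M) : M := op (w.map g).prod • m

variable {g}

theorem wordAct_append (w w' : List G) (m : M) :
    wordAct g (w ++ w') m = wordAct g w' (wordAct g w m) := by
  simp [wordAct, mul_smul]

@[simp] theorem wordAct_zero (w : List G) : wordAct g w (0 : M) = 0 := smul_zero _

theorem wordAct_add (w : List G) (m m' : M) :
    wordAct g w (m + m') = wordAct g w m + wordAct g w m' := smul_add _ _ _

theorem map_wordAct (f : M →ₗ[Aᵐᵒᵖ] N) (w : List G) (m : M) :
    f (wordAct g w m) = wordAct g w (f m) := map_smul f _ _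

theorem wordAct_mem (K : Submodule Aᵐᵒᵖ M) (w : List G) {m : M} (hm : m ∈ K) :
    wordAct g w m ∈ K := K.smul_mem _ hm

variable (g) in
/-- An element of a right module is torsion if it is killed by all words of some length `n`. -/
def IsTors (m : M) : Prop := ∃ n, ∀ w : List G, w.length = n → wordAct g w m = 0

theorem wordAct_eq_zero_of_le {n n' : ℕ} (hn : n ≤ n') {m : M}
    (h : ∀ w : List G, w.length = n → wordAct g w m = 0) (w : List G) (hw : w.length = n') :
    wordAct g w m = 0 := by
  rw [← List.take_append_drop n w, wordAct_append, h _ (by simp; omega), wordAct_zero]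

theorem IsTors.zero : IsTors g (0 : M) := ⟨0, fun _ _ => wordAct_zero _⟩

theorem IsTors.add {m m' : M} (h : IsTors g m) (h' : IsTors g m') : IsTors g (m + m') := by
  obtain ⟨n, h⟩ := h
  obtain ⟨n', h'⟩ := h'
  refine ⟨max n n', fun w hw => ?_⟩
  rw [wordAct_add, wordAct_eq_zero_of_le (le_max_left _ _) h w hw,
    wordAct_eq_zero_of_le (le_max_right _ _) h' w hw, add_zero]

theorem IsTors.map (f : M →ₗ[Aᵐᵒᵖ] N) {m : M} (h : IsTors g m) : IsTors g (f m) := by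
  obtain ⟨n, h⟩ := h
  exact ⟨n, fun w hw => by rw [← map_wordAct, h w hw, map_zero]⟩

theorem IsTors.of_map (f : M →ₗ[Aᵐᵒᵖ] N) (hf : Function.Injective f) {m : M}
    (h : IsTors g (f m)) : IsTors g m := by
  obtain ⟨n, h⟩ := h
  exact ⟨n, fun w hw => hf (by rw [map_wordAct, h w hw, map_zero])⟩

/-- Torsion may be tested after multiplication by all words of a given length; there are only
finitely many of them, which gives a common bound. -/
theorem IsTors.of_wordAct [Finite G] {m : M} (n : ℕ)
    (h : ∀ w : List G, w.length = n → IsTors g (wordAct g w m)) : IsTors g m := by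
  choose! d hd using h
  obtain ⟨D, hD⟩ := ((List.finite_length_eq G n).image d).bddAbove
  refine ⟨n + D, fun w hw => ?_⟩
  have hn : (w.take n).length = n := by simp; omega
  rw [← List.take_append_drop n w, wordAct_append]
  exact wordAct_eq_zero_of_le (hD ⟨_, hn, rfl⟩) (hd _ hn) _ (by simp; omega)

variable (g) in
/-- An isomorphism modulo torsion: the kernel consists of torsion elements, and every element of
the target is torsion modulo the image. -/
structure IsAlmostIso (f : M →ₗ[Aᵐᵒᵖ] N) : Prop where
  inj : ∀ m, f m = 0 → IsTors g m
  surj : ∀ y, ∃ n, ∀ w : List G, w.length = n → wordAct g w y ∈ LinearMap.range f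

theorem IsAlmostIso.id : IsAlmostIso g (LinearMap.id : M →ₗ[Aᵐᵒᵖ] M) where
  inj m hm := by
    obtain rfl : m = 0 := hm
    exact .zero
  surj y := ⟨0, fun w _ => ⟨_, rfl⟩⟩

theorem wordAct_mem_of_le {K : Submodule Aᵐᵒᵖ M} {n n' : ℕ} (hn : n ≤ n') {m : M}
    (h : ∀ w : List G, w.length = n → wordAct g w m ∈ K) (w : List G) (hw : w.length = n') :
    wordAct g w m ∈ K := by
  rw [← List.take_append_drop n w, wordAct_append]
  exact wordAct_mem K _ (h _ (by simp; omega))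

theorem IsAlmostIso.comp [Finite G] {f : M →ₗ[Aᵐᵒᵖ] N} {h : N →ₗ[Aᵐᵒᵖ] P}
    (hf : IsAlmostIso g f) (hh : IsAlmostIso g h) : IsAlmostIso g (h ∘ₗ f) where
  inj m hm := by
    obtain ⟨n, hn⟩ := hh.inj _ hm
    exact .of_wordAct n fun w hw => hf.inj _ (by rw [map_wordAct, hn w hw])
  surj y := by
    obtain ⟨n, hn⟩ := hh.surj y
    choose! x hx using hn
    choose d hd using hf.surj
    obtain ⟨D, hD⟩ := ((List.finite_length_eq G n).image fun w => d (x w)).bddAbove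
    refine ⟨n + D, fun w hw => ?_⟩
    have hn : (w.take n).length = n := by simp; omega
    obtain ⟨z, hz⟩ := wordAct_mem_of_le (hD ⟨_, hn, rfl⟩) (hd (x (w.take n))) (w.drop n)
      (by simp; omega)
    refine ⟨z, ?_⟩
    conv_rhs => rw [← List.take_append_drop n w, wordAct_append, ← hx _ hn, ← map_wordAct, ← hz]
    rfl

theorem IsAlmostIso.of_comp [Finite G] {f : M →ₗ[Aᵐᵒᵖ] N} {h : N →ₗ[Aᵐᵒᵖ] P}
    (hf : IsAlmostIso g f) (hc : IsAlmostIso g (h ∘ₗ f)) : IsAlmostIso g h where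
  inj x hx := by
    obtain ⟨n, hn⟩ := hf.surj x
    refine .of_wordAct n fun w hw => ?_
    obtain ⟨m, hm⟩ := hn w hw
    rw [← hm]
    refine (hc.inj m ?_).map f
    rw [LinearMap.comp_apply, hm, map_wordAct, hx, wordAct_zero]
  surj y := by
    obtain ⟨n, hn⟩ := hc.surj y
    exact ⟨n, fun w hw => LinearMap.range_comp_le_range f h (hn w hw)⟩

end Torsion

/-! ### Kernels, cokernels and exactness for graded modules -/

section GradedModules

variable {k : Type u} [Field k] {A : Type v} [Ring A] [Algebra k A]

namespace GrMod

variable {𝓐 : ℕ → Submodule k A}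

@[simp] theorem comp_lin {M N P : GrMod.{u, v, w} 𝓐} (f : M ⟶ N) (h : N ⟶ P) :
    (f ≫ h).lin = h.lin ∘ₗ f.lin := rfl

theorem hom_ext_apply {M N : GrMod.{u, v, w} 𝓐} {f h : M ⟶ N} (H : ∀ m, f.lin m = h.lin m) :
    f = h := Hom.ext (LinearMap.ext H)

/-- The inclusion of the kernel of a morphism. -/
def kerι {M N : GrMod.{u, v, w} 𝓐} (f : M ⟶ N) : ker f ⟶ M :=
  ⟨(LinearMap.ker f.lin).subtype, fun _ _ h => h⟩

/-- The projection onto the quotient by a graded submodule. -/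
def quotπ (M : GrMod.{u, v, w} 𝓐) (K : Submodule Aᵐᵒᵖ M.carrier) (hK : M.IsGradedSub K) :
    M ⟶ M.quot K hK := ⟨K.mkQ, fun _ m h => ⟨m, h, rfl⟩⟩

theorem kerι_comp {M N : GrMod.{u, v, w} 𝓐} (f : M ⟶ N) : kerι f ≫ f = 0 :=
  hom_ext_apply fun m => m.2

theorem injective_of_mono {M N : GrMod.{u, v, w} 𝓐} (f : M ⟶ N) [Mono f] :
    Function.Injective f.lin := by
  have h : kerι f = 0 := by
    rw [← cancel_mono f, kerι_comp, Limits.zero_comp]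
  rw [← LinearMap.ker_eq_bot, eq_bot_iff]
  intro m hm
  exact congrArg (fun z : ker f ⟶ M => z.lin ⟨m, hm⟩) h

theorem isGradedSub_range {M N : GrMod.{u, v, w} 𝓐} (f : M ⟶ N) :
    N.IsGradedSub (LinearMap.range f.lin) := by
  rintro _ ⟨m, rfl⟩ i
  exact ⟨M.proj i m, Hom.proj_comm f i m⟩

theorem eq_top_of_quotπ_eq_zero {M : GrMod.{u, v, w} 𝓐} {K : Submodule Aᵐᵒᵖ M.carrier}
    {hK : M.IsGradedSub K} (h : quotπ M K hK = 0) : K = ⊤ := by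
  rw [eq_top_iff]
  intro m _
  exact (Submodule.Quotient.mk_eq_zero K).1 (congrArg (fun z : M ⟶ M.quot K hK => z.lin m) h)

theorem surjective_of_epi {M N : GrMod.{u, v, w} 𝓐} (f : M ⟶ N) [Epi f] :
    Function.Surjective f.lin := by
  rw [← LinearMap.range_eq_top]
  refine eq_top_of_quotπ_eq_zero (hK := isGradedSub_range f) ?_
  rw [← cancel_epi f, Limits.comp_zero]
  exact hom_ext_apply fun m => (Submodule.Quotient.mk_eq_zero _).2 ⟨m, rfl⟩

theorem mem_range_of_exact {S : ShortComplex (GrMod.{u, v, w} 𝓐)} (hS : S.Exact)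
    {x : S.X₂.carrier} (hx : S.g.lin x = 0) : x ∈ LinearMap.range S.f.lin := by
  obtain ⟨h, hH⟩ := hS.condition
  let q := quotπ S.X₂ _ (isGradedSub_range S.f)
  have hq : S.f ≫ q = 0 := hom_ext_apply fun m => (Submodule.Quotient.mk_eq_zero _).2 ⟨m, rfl⟩
  have hl : h.left.hi.lift (Limits.KernelFork.ofι _ S.zero) ≫ h.left.i = S.f :=
    h.left.hi.fac (Limits.KernelFork.ofι _ S.zero) Limits.WalkingParallelPair.zero
  -- The map from the cycles to the cokernel of `S.f` factors through the homology, which is zero.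
  have h1 : h.left.i ≫ q = 0 := by
    let c := Limits.CokernelCofork.ofπ (f := h.left.hi.lift (Limits.KernelFork.ofι _ S.zero))
      (h.left.i ≫ q) (by rw [← Category.assoc, hl, hq])
    have := h.left.hπ.fac c Limits.WalkingParallelPair.one
    refine this.symm.trans ?_
    change h.left.π ≫ h.left.hπ.desc c = 0
    rw [hH.eq_of_src (h.left.hπ.desc c) 0, Limits.comp_zero]
  have h2 : h.left.hi.lift (Limits.KernelFork.ofι (kerι S.g) (kerι_comp S.g)) ≫ h.left.i =
      kerι S.g :=
    h.left.hi.fac (Limits.KernelFork.ofι (kerι S.g) (kerι_comp S.g))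
      Limits.WalkingParallelPair.zero
  have h3 : kerι S.g ≫ q = 0 := by rw [← h2, Category.assoc, h1, Limits.comp_zero]
  exact (Submodule.Quotient.mk_eq_zero _).1
    (congrArg (fun z : ker S.g ⟶ _ => z.lin ⟨x, hx⟩) h3)

/-- The images of a jointly epimorphic family, such as the injections into a coproduct, span. -/
theorem iSup_range_eq_top {J : Type*} {X : J → GrMod.{u, v, w} 𝓐} {Y : GrMod.{u, v, w} 𝓐}
    (f : ∀ j, X j ⟶ Y)
    (hf : ∀ (Z : GrMod.{u, v, w} 𝓐) (a b : Y ⟶ Z), (∀ j, f j ≫ a = f j ≫ b) → a = b) :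
    ⨆ j, LinearMap.range (f j).lin = ⊤ := by
  have hK : Y.IsGradedSub (⨆ j, LinearMap.range (f j).lin) := by
    intro m hm i
    induction hm using Submodule.iSup_induction' with
    | mem j x hx => exact Submodule.mem_iSup_of_mem j (isGradedSub_range _ x hx i)
    | zero => rw [map_zero]; exact zero_mem _
    | add x y _ _ hx hy => rw [map_add]; exact add_mem hx hy
  refine eq_top_of_quotπ_eq_zero (hK := hK) (hf _ _ _ fun j => ?_)
  rw [Limits.comp_zero]
  exact hom_ext_apply fun m =>
    (Submodule.Quotient.mk_eq_zero _).2 (Submodule.mem_iSup_of_mem j ⟨m, rfl⟩)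

/-! ### Torsion modules form a localizing subcategory -/

variable {G : Type*} (g : G → A)

variable (𝓐) in
/-- The graded modules all of whose elements are torsion. -/
def torsion : ObjectProperty (GrMod.{u, v, w} 𝓐) := fun M => ∀ m : M.carrier, IsTors g m

theorem isoMod_torsion_iff {M N : GrMod.{u, v, w} 𝓐} (f : M ⟶ N) :
    isoMod (torsion 𝓐 g) f ↔ IsAlmostIso g f.lin := by
  refine ⟨fun h => ⟨fun m hm => ?_, fun y => ?_⟩, fun h => ⟨fun m => ?_, fun y => ?_⟩⟩
  · exact (h.1 ⟨m, hm⟩).map (kerι f).lin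
  · obtain ⟨n, hn⟩ := h.2 ((LinearMap.range f.lin).mkQ y)
    exact ⟨n, fun w hw => (Submodule.Quotient.mk_eq_zero _).1 (hn w hw)⟩
  · exact (h.inj m.1 m.2).of_map (kerι f).lin Subtype.val_injective
  · obtain ⟨y, rfl⟩ := (LinearMap.range f.lin).mkQ_surjective y
    obtain ⟨n, hn⟩ := h.surj y
    exact ⟨n, fun w hw => (Submodule.Quotient.mk_eq_zero _).2 (hn w hw)⟩

variable (𝓐) in
/-- The zero module as a graded module. -/
def zeroObj : GrMod.{u, v, w} 𝓐 where
  carrier := PUnit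
  gr _ := (⊥ : Submodule k PUnit.{w + 1})
  dec := (isInternal_of_proj _ 0 (fun _ _ _ => Subsingleton.elim _ _)
    (fun _ _ _ _ _ => rfl) (Subsingleton.elim _ _)).chooseDecomposition
  smul_mem _ _ := Subsingleton.elim _ _

instance : Subsingleton (zeroObj.{u, v, w} 𝓐).carrier := inferInstanceAs (Subsingleton PUnit)

theorem isZero_zeroObj : Limits.IsZero (zeroObj.{u, v, w} 𝓐) where
  unique_to Y := ⟨⟨⟨0⟩, fun f => hom_ext_apply fun m => by
    rw [Subsingleton.elim m 0, map_zero, map_zero]⟩⟩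
  unique_from Y := ⟨⟨⟨0⟩, fun f => hom_ext_apply fun m => Subsingleton.elim _ _⟩⟩

theorem isLocalizing_torsion [Finite G] : IsLocalizing (torsion.{u, v, w} 𝓐 g) where
  zero := ⟨zeroObj 𝓐, isZero_zeroObj, fun m => ⟨0, fun _ _ => Subsingleton.elim _ _⟩⟩
  sub := ⟨fun f _ hY x => (hY (f.lin x)).of_map f.lin (injective_of_mono f)⟩
  quot := ⟨fun f _ hX y => by
    obtain ⟨x, rfl⟩ := surjective_of_epi f y
    exact (hX x).map f.lin⟩
  ext := ⟨fun {S} hS h₁ h₃ x => by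
    obtain ⟨n, hn⟩ := h₃ (S.g.lin x)
    refine .of_wordAct n fun w hw => ?_
    obtain ⟨y, hy⟩ := mem_range_of_exact hS.exact
      (x := wordAct g w x) (by rw [map_wordAct, hn w hw])
    rw [← hy]
    exact (h₁ y).map S.f.lin⟩
  coprod J := ⟨fun X ⟨c⟩ x => by
    let f : ∀ j, c.diag.obj j ⟶ X := c.ι.app
    have hx : x ∈ ⨆ j, LinearMap.range (f j).lin := by
      rw [iSup_range_eq_top f fun Z a b h => c.isColimit.hom_ext h]
      exact Submodule.mem_top
    induction hx using Submodule.iSup_induction' with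
    | mem j x hx =>
      obtain ⟨y, rfl⟩ := hx
      exact (c.prop_diag_obj j y).map _
    | zero => exact .zero
    | add x y _ _ hx hy => exact hx.add hy⟩

end GrMod

end GradedModules

/-! ### Equivalence of quotient categories from a change of rings -/

section ChangeOfRings

variable {k : Type u} [Field k] {A : Type v} [Ring A] [Algebra k A] {𝓐 : ℕ → Submodule k A}
  {B : Type v'} [Ring B] [Algebra k B] {ℬ : ℕ → Submodule k B}

namespace GrMod

section Restriction

variable (φ : A →ₐ[k] B) (hφ : ∀ n, ∀ a ∈ 𝓐 n, φ a ∈ ℬ n)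

/-- The restriction of a morphism of graded modules along `φ`. -/
def restrictMap {N P : GrMod.{u, v', w} ℬ} (f : N ⟶ P) :
    restrict (𝓐 := 𝓐) φ hφ N ⟶ restrict φ hφ P where
  lin := { f.lin with map_smul' := fun a m => f.lin.map_smul (op (φ a.unop)) m }
  map_mem := f.map_mem

/-- Restriction of scalars as a functor `Gr B ⥤ Gr A`. -/
def restrictFunctor : GrMod.{u, v', w} ℬ ⥤ GrMod.{u, v, w} 𝓐 where
  obj N := restrict φ hφ N
  map f := restrictMap φ hφ f

variable {G : Type*} {g : G → A} {N P : GrMod.{u, v', w} ℬ}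

theorem wordAct_restrict (w : List G) (m : N.carrier) :
    wordAct (M := (restrict (𝓐 := 𝓐) φ hφ N).carrier) g w m = wordAct (φ ∘ g) w m := by
  change op (φ (w.map g).prod) • m = op (w.map (φ ∘ g)).prod • m
  rw [map_list_prod, List.map_map]

theorem isTors_restrict_iff (m : N.carrier) :
    IsTors (M := (restrict (𝓐 := 𝓐) φ hφ N).carrier) g m ↔ IsTors (φ ∘ g) m :=
  exists_congr fun _ => forall₂_congr fun w _ =>
    Eq.congr_left (wordAct_restrict (𝓐 := 𝓐) φ hφ (g := g) w m)

theorem isAlmostIso_restrict_iff (f : N ⟶ P) :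
    IsAlmostIso g (restrictMap (𝓐 := 𝓐) φ hφ f).lin ↔ IsAlmostIso (φ ∘ g) f.lin := by
  have h1 (m : N.carrier) := isTors_restrict_iff (𝓐 := 𝓐) φ hφ (g := g) (N := N) m
  have h2 (w : List G) (y : P.carrier) :
      wordAct (M := (restrict (𝓐 := 𝓐) φ hφ P).carrier) g w y ∈
        LinearMap.range (restrictMap (𝓐 := 𝓐) φ hφ f).lin ↔
      wordAct (φ ∘ g) w y ∈ LinearMap.range f.lin := by
    rw [wordAct_restrict]
    rfl
  exact ⟨fun h => ⟨fun m hm => (h1 m).1 (h.inj m hm), fun y =>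
      (h.surj y).imp fun n hn w hw => (h2 w y).1 (hn w hw)⟩,
    fun h => ⟨fun m hm => (h1 m).2 (h.inj m hm), fun y =>
      (h.surj y).imp fun n hn w hw => (h2 w y).2 (hn w hw)⟩⟩

end Restriction

section Adjunction

variable (φ : A →ₐ[k] B) (hφ : ∀ n, ∀ a ∈ 𝓐 n, φ a ∈ ℬ n)

theorem pure_add (M : GrMod.{u, v, w} 𝓐) (m m' : M.carrier) (b : B) :
    pure φ M (m + m') b = pure φ M m b + pure φ M m' b := by
  rw [pure, TensorProduct.tmul_add, map_add]; rfl

/-- The section `s` extends to `M ⊗_A B → M`, `m ⊗ b ↦ m · s b`. -/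
theorem contract_eq_zero (M : GrMod.{u, v, w} 𝓐) {φ : A →ₐ[k] B} {s : B →ₗ[k] A}
    (hs : ∀ a b, s (φ a * b) = a * s b) {x : B ⊗[k] M.carrier} (hx : x ∈ tensorRel φ M) :
    TensorProduct.lift ((Algebra.lsmul k k M.carrier).toLinearMap ∘ₗ
      (MulOpposite.opLinearEquiv k).toLinearMap ∘ₗ s) x = 0 := by
  set L := TensorProduct.lift ((Algebra.lsmul k k M.carrier).toLinearMap ∘ₗ
      (MulOpposite.opLinearEquiv k).toLinearMap ∘ₗ s)
  have hL : ∀ b m, L (b ⊗ₜ m) = op (s b) • m := fun b m => rfl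
  suffices h : ∀ c : Bᵐᵒᵖ, L (c • x) = 0 by simpa using h 1
  induction hx using Submodule.span_induction with
  | mem x hx =>
    obtain ⟨b, m, a, rfl⟩ := hx
    intro c
    rw [smul_sub, map_sub, sub_eq_zero, TensorProduct.smul_tmul', TensorProduct.smul_tmul',
      hL, hL, smul_smul]
    congr 1
    induction c with | _ c =>
    rw [op_smul_eq_mul, op_smul_eq_mul, mul_assoc, hs, op_mul]
  | zero => simp
  | add x y _ _ hx hy => intro c; rw [smul_add, map_add, hx, hy, add_zero]
  | smul r x _ hx => intro c; rw [smul_smul]; exact hx _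

/-- The natural map `M → M ⊗_A B`, `m ↦ m ⊗ 1`, where `A` acts on `M ⊗_A B` through `φ`. -/
def unitHom [GradedAlgebra 𝓐] [GradedAlgebra ℬ] (M : GrMod.{u, v, max v' w} 𝓐) :
    M ⟶ restrict φ hφ (tensor.{u, v, v', w} φ hφ M) where
  lin :=
    { toFun := fun m => pure φ M m 1
      map_add' := fun m m' => pure_add φ M m m' 1
      map_smul' := fun a m => by
        refine (pure_rel φ M m a.unop 1).trans ?_
        rw [mul_one, ← one_mul (φ a.unop)]
        rfl }
  map_mem i m hm := by
    change pure φ M m 1 ∈ tensorGr φ ℬ M i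
    exact Submodule.subset_span ⟨i, 0, m, 1, hm, SetLike.GradedOne.one_mem, by simp, rfl⟩

/-- The multiplication `N ⊗_k B → N`, `n ⊗ b ↦ n · b`, on the level of modules. -/
def mulRight (N : GrMod.{u, v', w} ℬ) : B ⊗[k] N.carrier →ₗ[Bᵐᵒᵖ] N.carrier :=
  TensorProduct.AlgebraTensorModule.lift
    { toFun := fun b => Algebra.lsmul k k N.carrier (op b)
      map_add' := fun b b' => by rw [MulOpposite.op_add, map_add]
      map_smul' := fun c b => LinearMap.ext fun m => mul_smul c (op b) m }

/-- The multiplication `N ⊗_A B → N`, `n ⊗ b ↦ n · b`, on the level of modules. -/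
def counitLin (N : GrMod.{u, v', w} ℬ) :
    Tensor φ (restrict (𝓐 := 𝓐) φ hφ N) →ₗ[Bᵐᵒᵖ] N.carrier :=
  (tensorRel φ (restrict (𝓐 := 𝓐) φ hφ N)).liftQ (mulRight N)
    (Submodule.span_le.2 (by
      rintro _ ⟨b, m, a, rfl⟩
      refine (LinearMap.mem_ker.2 ((map_sub (mulRight N) _ _).trans (sub_eq_zero.2 ?_)))
      let m' : N.carrier := m
      change op b • op (φ a) • m' = op (φ a * b) • m'
      rw [op_mul, mul_smul]))

theorem counitLin_mem (N : GrMod.{u, v', w} ℬ) {d : ℤ}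
    {x : Tensor φ (restrict (𝓐 := 𝓐) φ hφ N)}
    (hx : x ∈ tensorGr φ ℬ (restrict (𝓐 := 𝓐) φ hφ N) d) : counitLin φ hφ N x ∈ N.gr d := by
  induction hx using Submodule.span_induction with
  | mem x hx =>
    obtain ⟨i, n, m, b, hm, hb, rfl, rfl⟩ := hx
    exact N.smul_mem hm hb
  | zero => rw [map_zero]; exact zero_mem _
  | add x y _ _ hx hy => rw [map_add]; exact add_mem hx hy
  | smul r x _ hx =>
    have := ((counitLin φ hφ N).restrictScalars k).map_smul r x
    exact this ▸ Submodule.smul_mem _ _ hx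

variable [GradedAlgebra 𝓐] [GradedAlgebra ℬ]

/-- The natural map `N ⊗_A B → N`, `n ⊗ b ↦ n · b`. -/
def counitHom (N : GrMod.{u, v', max v' w} ℬ) :
    tensor.{u, v, v', w} φ hφ (restrict (𝓐 := 𝓐) φ hφ N) ⟶ N where
  lin := counitLin φ hφ N
  map_mem _ _ hx := counitLin_mem φ hφ N hx

theorem unitHom_counitHom (N : GrMod.{u, v', max v' w} ℬ) :
    unitHom.{u, v, v', w} φ hφ (restrict (𝓐 := 𝓐) φ hφ N) ≫
      restrictMap φ hφ (counitHom.{u, v, v', w} φ hφ N) = 𝟙 _ :=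
  hom_ext_apply fun m => one_smul Bᵐᵒᵖ (show N.carrier from m)

/-- The unit of the adjunction between `- ⊗_A B` and restriction. -/
def unit : 𝟭 (GrMod.{u, v, max v' w} 𝓐) ⟶
    tensorFunctor.{u, v, v', w} φ hφ ⋙ restrictFunctor φ hφ where
  app M := unitHom.{u, v, v', w} φ hφ M

/-- The counit of the adjunction between `- ⊗_A B` and restriction. -/
def counit : restrictFunctor φ hφ ⋙ tensorFunctor.{u, v, v', w} φ hφ ⟶
    𝟭 (GrMod.{u, v', max v' w} ℬ) where
  app N := counitHom.{u, v, v', w} φ hφ N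
  naturality N _ f := Hom.ext (tensor_hom_ext φ fun m b =>
    (f.lin.map_smul (op b) (show N.carrier from m)).symm)

variable {φ} {G : Type*} {g : G → A}

variable (φ g) in
/-- A partial section of `φ : A → B` for words of length `ℓ` in the letters `g x`: every such word
`w` is the value at `1` of a homomorphism `s : B → A` of left `A`-modules with `φ ∘ s` the right
multiplication by `φ w`.  So `w` annihilates the kernel of `φ` and maps `B` into its image. -/
def HasWordSections (ℓ : ℕ) : Prop :=
  ∀ w : List G, w.length = ℓ → ∃ s : B →ₗ[k] A, (∀ a b, s (φ a * b) = a * s b) ∧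
    s 1 = (w.map g).prod ∧ ∀ b, φ (s b) = b * φ (w.map g).prod

/-- If `m ⊗ 1 = 0` then `m · w = m · s 1 = 0` for all words `w` of length `ℓ`, and
`(m ⊗ b) · w = m ⊗ φ (s b) = (m · s b) ⊗ 1`. -/
theorem isAlmostIso_unit {ℓ : ℕ} (h : HasWordSections φ g ℓ) (M : GrMod.{u, v, max v' w} 𝓐) :
    IsAlmostIso g (unitHom.{u, v, v', w} φ hφ M).lin where
  inj m hm := by
    refine ⟨ℓ, fun w hw => ?_⟩
    obtain ⟨s, hs, h1, -⟩ := h w hw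
    have := contract_eq_zero M hs ((Submodule.Quotient.mk_eq_zero _).1 hm)
    change op (s 1) • m = 0 at this
    rwa [h1] at this
  surj y := by
    refine ⟨ℓ, fun w hw => ?_⟩
    obtain ⟨s, hs, -, h2⟩ := h w hw
    obtain ⟨x, rfl⟩ := (tensorRel φ M).mkQ_surjective y
    induction x with
    | zero => rw [map_zero]; exact wordAct_mem _ w (zero_mem _)
    | add x y hx hy => rw [map_add]; erw [wordAct_add]; exact add_mem hx hy
    | tmul b m =>
      refine ⟨op (s b) • m, ?_⟩
      change pure φ M (op (s b) • m) 1 = pure φ M m (b * φ (w.map g).prod)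
      rw [pure_rel, mul_one, h2]

theorem isAlmostIso_counit [Finite G] {ℓ : ℕ} (h : HasWordSections φ g ℓ)
    (N : GrMod.{u, v', max v' w} ℬ) :
    IsAlmostIso (φ ∘ g) (counitHom.{u, v, v', w} (𝓐 := 𝓐) φ hφ N).lin := by
  rw [← isAlmostIso_restrict_iff (𝓐 := 𝓐) φ hφ]
  refine (isAlmostIso_unit hφ h (restrict φ hφ N)).of_comp ?_
  rw [← comp_lin, unitHom_counitHom]
  exact IsAlmostIso.id

/-- The functor `- ⊗_A B` preserves isomorphisms modulo torsion, although it need not be exact: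
this follows from naturality of the unit. -/
theorem isAlmostIso_tensor [Finite G] {ℓ : ℕ} (h : HasWordSections φ g ℓ)
    {M M' : GrMod.{u, v, max v' w} 𝓐} (f : M ⟶ M') (hf : IsAlmostIso g f.lin)
    {f' : tensor.{u, v, v', w} φ hφ M ⟶ tensor.{u, v, v', w} φ hφ M'}
    (hf' : f' = (tensorFunctor.{u, v, v', w} φ hφ).map f) : IsAlmostIso (φ ∘ g) f'.lin := by
  rw [← isAlmostIso_restrict_iff (𝓐 := 𝓐) φ hφ]
  refine (isAlmostIso_unit hφ h M).of_comp ?_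
  have e : unitHom.{u, v, v', w} φ hφ M ≫ restrictMap φ hφ f' =
      f ≫ unitHom.{u, v, v', w} φ hφ M' := by
    subst hf'
    rfl
  rw [← comp_lin, e]
  exact hf.comp (isAlmostIso_unit hφ h M')

/-- Tensoring along `φ` and restricting along `φ` are inverse to each other modulo torsion, since
unit and counit are isomorphisms modulo torsion. -/
theorem exists_equivalence_of_eq_torsion [Finite G] {ℓ : ℕ} (h : HasWordSections φ g ℓ)
    {T : ObjectProperty (GrMod.{u, v, max v' w} 𝓐)} (hT : T = torsion 𝓐 g)
    {T' : ObjectProperty (GrMod.{u, v', max v' w} ℬ)} (hT' : T' = torsion ℬ (φ ∘ g)) :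
    ∃ Φ : QuotCat T ⥤ QuotCat T', Φ.IsEquivalence ∧
      Nonempty (toQuot T ⋙ Φ ≅ tensorFunctor.{u, v, v', w} φ hφ ⋙ toQuot T') := by
  subst hT hT'
  let W₁ := isoMod (torsion.{u, v, max v' w} 𝓐 g)
  let W₂ := isoMod (torsion.{u, v', max v' w} ℬ (φ ∘ g))
  let L := tensorFunctor.{u, v, v', w} φ hφ
  let R : GrMod.{u, v', max v' w} ℬ ⥤ GrMod.{u, v, max v' w} 𝓐 := restrictFunctor φ hφ
  let η : 𝟭 _ ⟶ L ⋙ R := unit.{u, v, v', w} φ hφ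
  let ε : R ⋙ L ⟶ 𝟭 _ := counit.{u, v, v', w} φ hφ
  have hL : W₁.IsInvertedBy (L ⋙ W₂.Q) := fun M M' f hf =>
    Localization.inverts W₂.Q W₂ (L.map f) ((isoMod_torsion_iff (φ ∘ g) (L.map f)).2
      (isAlmostIso_tensor hφ h f ((isoMod_torsion_iff g f).1 hf) rfl))
  have hR : W₂.IsInvertedBy (R ⋙ W₁.Q) := fun N N' f hf =>
    Localization.inverts W₁.Q W₁ (R.map f) ((isoMod_torsion_iff g (R.map f)).2
      ((isAlmostIso_restrict_iff φ hφ f).2 ((isoMod_torsion_iff _ f).1 hf)))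
  let L' := Localization.lift (L ⋙ W₂.Q) hL W₁.Q
  let R' := Localization.lift (R ⋙ W₁.Q) hR W₂.Q
  have : IsIso (Functor.whiskerRight η W₁.Q) := by
    rw [NatTrans.isIso_iff_isIso_app]
    exact fun M => Localization.inverts W₁.Q W₁ _ 
      ((isoMod_torsion_iff g (unitHom φ hφ M)).2 (isAlmostIso_unit hφ h M))
  have : IsIso (Functor.whiskerRight ε W₂.Q) := by
    rw [NatTrans.isIso_iff_isIso_app]
    exact fun N => Localization.inverts W₂.Q W₂ _ 
      ((isoMod_torsion_iff _ (counitHom φ hφ N)).2 (isAlmostIso_counit hφ h N))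
  let eL : W₁.Q ⋙ L' ≅ L ⋙ W₂.Q := Localization.fac _ _ _
  let eR : W₂.Q ⋙ R' ≅ R ⋙ W₁.Q := Localization.fac _ _ _
  refine ⟨L', Localization.isEquivalence W₁.Q W₁ W₂.Q W₂ (L ⋙ W₂.Q) L' (R ⋙ W₁.Q) R'
    (Functor.associator _ _ _ ≪≫ Functor.isoWhiskerLeft L eR ≪≫ (Functor.associator _ _ _).symm ≪≫
      (asIso (Functor.whiskerRight η W₁.Q)).symm ≪≫ Functor.leftUnitor _)
    (Functor.associator _ _ _ ≪≫ Functor.isoWhiskerLeft R eL ≪≫ (Functor.associator _ _ _).symm ≪≫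
      asIso (Functor.whiskerRight ε W₂.Q) ≪≫ Functor.leftUnitor _), ⟨eL⟩⟩

end Adjunction

end GrMod

end ChangeOfRings

/-! ### Torsion modules over a monomial algebra -/

section Monomial

variable (k : Type u) [Field k] {G : Type v} (F : Finset (List G)) (deg : G → ℕ)

/-- The letters of the monomial algebra. -/
def letter (x : G) : MonomialAlgebra k F := MonomialAlgebra.mkWord k F [x]

theorem prod_map_letter (w : List G) :
    (w.map (letter k F)).prod = MonomialAlgebra.mkWord k F w := by
  induction w with
  | nil => simp [MonomialAlgebra.mkWord_nil]
  | cons x w ih =>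
    rw [List.map_cons, List.prod_cons, ih, letter, ← MonomialAlgebra.mkWord_append]; rfl

theorem wordAct_letter {M : Type*} [AddCommGroup M] [Module (MonomialAlgebra k F)ᵐᵒᵖ M]
    (w : List G) (m : M) :
    wordAct (letter k F) w m = op (MonomialAlgebra.mkWord k F w) • m := by
  rw [wordAct, prod_map_letter]

theorem span_mkWord : Submodule.span k (Set.range (MonomialAlgebra.mkWord k F)) = ⊤ := by
  rw [eq_top_iff, ← (DirectSum.Decomposition.isInternal
    (MonomialAlgebra.gr k F 0)).submodule_iSup_eq_top]
  refine iSup_le fun n => Submodule.span_mono ?_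
  rintro _ ⟨w, -, rfl⟩
  exact ⟨w, rfl⟩

variable {k F} in
theorem MonomialAlgebra.word_induction {P : MonomialAlgebra k F → Prop} (a : MonomialAlgebra k F)
    (zero : P 0) (add : ∀ x y, P x → P y → P (x + y)) (smul : ∀ (c : k) x, P x → P (c • x))
    (word : ∀ w, P (MonomialAlgebra.mkWord k F w)) : P a := by
  have ha : a ∈ Submodule.span k (Set.range (MonomialAlgebra.mkWord k F)) :=
    span_mkWord k F ▸ Submodule.mem_top
  induction ha using Submodule.span_induction with
  | mem x hx => obtain ⟨w, rfl⟩ := hx; exact word w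
  | zero => exact zero
  | add x y _ _ hx hy => exact add x y hx hy
  | smul c x _ hx => exact smul c x hx

theorem mkWord_mem_gr (w : List G) :
    MonomialAlgebra.mkWord k F w ∈ MonomialAlgebra.gr k F deg (MonomialAlgebra.wordDeg deg w) :=
  Submodule.subset_span ⟨w, rfl, rfl⟩

variable {deg} in
theorem length_le_wordDeg (hdeg : ∀ x, 1 ≤ deg x) (w : List G) :
    w.length ≤ MonomialAlgebra.wordDeg deg w := by
  induction w with
  | nil => simp
  | cons x w ih =>
    have := hdeg x
    simp only [MonomialAlgebra.wordDeg, List.map_cons, List.sum_cons, List.length_cons] at ih ⊢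
    omega

variable {k F deg}

namespace GrMod

theorem eq_zero_of_proj {M : GrMod.{u, max u v, w} (grA k F deg)} {m : M.carrier}
    (h : ∀ i, M.proj i m = 0) : m = 0 := by
  classical
  rw [← DirectSum.sum_support_decompose M.gr m]
  exact Finset.sum_eq_zero fun i _ => h i

/-- The degrees of the elements of a finite-dimensional submodule are bounded. -/
theorem exists_bound_proj {M : GrMod.{u, max u v, w} (grA k F deg)}
    (K : Submodule (MonomialAlgebra k F)ᵐᵒᵖ M.carrier) [hK : Module.Finite k K] :
    ∃ D : ℕ, ∀ i : ℤ, D < i.natAbs → ∀ x ∈ K, M.proj i x = 0 := by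
  classical
  obtain ⟨S, hS⟩ := hK.fg_top
  refine ⟨S.sup fun s => (DirectSum.decompose M.gr (s : M.carrier)).support.sup Int.natAbs,
    fun i hi x hx => ?_⟩
  have hx' : (⟨x, hx⟩ : K) ∈ Submodule.span k (S : Set K) := hS ▸ Submodule.mem_top
  refine (Submodule.span_le.2 ?_ :
    _ ≤ LinearMap.ker (M.proj i ∘ₗ K.subtype.restrictScalars k)) hx'
  intro s hs
  rw [SetLike.mem_coe, LinearMap.mem_ker]
  by_contra hne
  refine hi.not_ge (le_trans ?_ (Finset.le_sup hs))
  refine Finset.le_sup (f := Int.natAbs) (DFinsupp.mem_support_iff.2 fun h0 => hne ?_)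
  change ((DirectSum.decompose M.gr (s : M.carrier) i : M.gr i) : M.carrier) = 0
  rw [h0]; rfl

/-- Since letters have positive degree, long words move the finite-dimensional submodule `K` out of
the range of its degrees. -/
theorem isTors_of_mem_finite (hdeg : ∀ x, 1 ≤ deg x) {M : GrMod.{u, max u v, w} (grA k F deg)}
    (K : Submodule (MonomialAlgebra k F)ᵐᵒᵖ M.carrier) [Module.Finite k K] {x : M.carrier}
    (hx : x ∈ K) : IsTors (letter k F) x := by
  obtain ⟨D, hD⟩ := exists_bound_proj K
  refine ⟨2 * D + 1, fun w hw => eq_zero_of_proj fun i => ?_⟩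
  have hle := length_le_wordDeg hdeg w
  by_cases hi : D < i.natAbs
  · exact hD i hi _ (wordAct_mem K w hx)
  · rw [wordAct_letter, M.proj_smul (mkWord_mem_gr k F deg w), hD _ (by omega) x hx, smul_zero]

theorem isGradedSub_span_singleton {M : GrMod.{u, max u v, w} (grA k F deg)} {i : ℤ}
    {m : M.carrier} (hm : m ∈ M.gr i) :
    M.IsGradedSub (Submodule.span (MonomialAlgebra k F)ᵐᵒᵖ {m}) := by
  intro y hy j
  obtain ⟨a, rfl⟩ := Submodule.mem_span_singleton.1 hy
  induction a with | _ a =>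
  induction a using DirectSum.Decomposition.inductionOn (grA k F deg) with
  | zero => rw [op_zero, zero_smul, map_zero]; exact zero_mem _
  | add a b ha hb =>
    rw [MulOpposite.op_add, add_smul, map_add]
    exact add_mem (ha (Submodule.mem_span_singleton.2 ⟨_, rfl⟩))
      (hb (Submodule.mem_span_singleton.2 ⟨_, rfl⟩))
  | @homogeneous n a =>
    have := M.smul_mem hm a.2
    by_cases h : i + n = j
    · subst h
      rw [M.proj_same this]
      exact hy
    · rw [M.proj_ne this h]
      exact zero_mem _

/-- A torsion element generates a finite-dimensional submodule: its multiples by the finitely many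
short words span it. -/
theorem finite_span_singleton [Finite G] {M : GrMod.{u, max u v, w} (grA k F deg)}
    {m : M.carrier} (hm : IsTors (letter k F) m) :
    Module.Finite k (Submodule.span (MonomialAlgebra k F)ᵐᵒᵖ {m}) := by
  obtain ⟨n, hn⟩ := hm
  have hfin : ((fun w => wordAct (letter k F) w m) '' {w : List G | w.length < n}).Finite :=
    (List.finite_length_lt G n).image _
  have := FiniteDimensional.span_of_finite k hfin
  suffices h : (Submodule.span (MonomialAlgebra k F)ᵐᵒᵖ {m}).restrictScalars k ≤
      Submodule.span k ((fun w => wordAct (letter k F) w m) '' {w : List G | w.length < n}) from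
    Submodule.finiteDimensional_of_le h
  intro y hy
  obtain ⟨a, rfl⟩ := Submodule.mem_span_singleton.1 hy
  clear hy
  induction a with | _ a =>
  induction a using MonomialAlgebra.word_induction with
  | zero => rw [op_zero, zero_smul]; exact zero_mem _
  | add a b ha hb => rw [MulOpposite.op_add, add_smul]; exact add_mem ha hb
  | smul c a ha => rw [op_smul, smul_assoc]; exact Submodule.smul_mem _ _ ha
  | word w =>
    rw [← wordAct_letter]
    by_cases hw : w.length < n
    · exact Submodule.subset_span ⟨w, hw, rfl⟩
    · rw [wordAct_eq_zero_of_le (not_lt.1 hw) hn w rfl]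
      exact zero_mem _

/-- `Fdim A` consists of the graded modules each of whose elements is killed by all words of some
length. -/
theorem Fdim_eq_torsion [Finite G] (hdeg : ∀ x, 1 ≤ deg x) :
    Fdim.{u, max u v, w} (grA k F deg) = torsion (grA k F deg) (letter k F) := by
  ext M
  refine ⟨fun h m => ?_, fun h => ?_⟩
  · have hm : m ∈ sSup {K : Submodule (MonomialAlgebra k F)ᵐᵒᵖ M.carrier |
        M.IsGradedSub K ∧ Module.Finite k K} := h.symm ▸ Submodule.mem_top
    rw [sSup_eq_iSup'] at hm
    induction hm using Submodule.iSup_induction' with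
    | mem K x hx =>
      have := K.2.2
      exact isTors_of_mem_finite hdeg K.1 hx
    | zero => exact .zero
    | add x y _ _ hx hy => exact hx.add hy
  · refine eq_top_iff.2 fun m _ => ?_
    induction m using DirectSum.Decomposition.inductionOn M.gr with
    | zero => exact zero_mem _
    | add x y hx hy => exact add_mem (hx trivial) (hy trivial)
    | @homogeneous i m =>
      exact Submodule.mem_sSup_of_mem (S := {K : Submodule (MonomialAlgebra k F)ᵐᵒᵖ M.carrier |
          M.IsGradedSub K ∧ Module.Finite k K})
        ⟨isGradedSub_span_singleton m.2, finite_span_singleton (h m)⟩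
        (Submodule.mem_span_singleton_self _)

end GrMod

end Monomial

/-! ### Words and paths in the Ufnarovskii graph -/

section Ufnarovskii

variable (k : Type u) [Field k] {G : Type v} {F : Finset (List G)}

theorem mkWord_eq_zero_of_not_legal {w : List G} (h : ¬ Legal F w) :
    MonomialAlgebra.mkWord k F w = 0 := by
  simp only [Legal, not_forall, not_not] at h
  obtain ⟨f, hf, s, t, rfl⟩ := h
  rw [MonomialAlgebra.mkWord_append, MonomialAlgebra.mkWord_append,
    MonomialAlgebra.mkWord_eq_zero k F hf, mul_zero, zero_mul]

theorem LegalWord.source_append (e : UfArrow F) : ∃ y, e.word = e.source.word ++ [y] :=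
  ⟨_, (List.dropLast_append_getLast (List.ne_nil_of_length_pos (by rw [e.length_eq]; omega))).symm⟩

theorem LegalWord.label_cons (e : UfArrow F) : e.label :: e.target.word = e.word :=
  List.cons_head_tail _

theorem pathLabel_cons_arrow {v : UfVertex F} (e : UfArrow F) (p : Quiver.Path v e.source) :
    pathLabel (p.cons e.arrow) = pathLabel p ++ [e.label] := by
  simp [pathLabel, LegalWord.arrow]

/-- A path begins at the word formed by the first `ℓ` letters of its label and its endpoint. -/
theorem source_prefix {v u : UfVertex F} (p : Quiver.Path v u) :
    v.word <+: pathLabel p ++ u.word := by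
  induction p with
  | nil => simp [pathLabel]
  | @cons u t p e ih =>
    obtain ⟨e, rfl, rfl⟩ := e
    obtain ⟨y, hy⟩ := e.source_append
    change _ <+: pathLabel (p.cons e.arrow) ++ e.target.word
    rw [pathLabel_cons_arrow, List.append_assoc, List.singleton_append, e.label_cons, hy,
      ← List.append_assoc]
    exact ih.trans (List.prefix_append _ _)

theorem source_eq_of_pathLabel_eq {v u : UfVertex F} (p : Quiver.Path v u)
    (h : (pathLabel p).length = ell F) : v.word = pathLabel p :=
  (List.prefix_of_prefix_length_le (source_prefix p) (List.prefix_append _ _)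
    (by rw [v.length_eq, h])).eq_of_length (by rw [v.length_eq, h])

variable [Finite G]

theorem ufHom_mem_labelSpan (w : List G) :
    ufHom k F (MonomialAlgebra.mkWord k F w) ∈ labelSpan k F w := by
  rw [ufHom_mkWord]
  exact lift_word_mem k F w

theorem ufHom_letter (x : G) : ufHom k F (letter k F x) = labelSum k F x := by
  rw [letter, ufHom_mkWord]
  simp [word]

/-- A word of length `ℓ` labels only paths starting at the vertex given by this word. -/
theorem ofPath_mul_ufHom_of_ne {v u : UfVertex F} (p : Quiver.Path v u) {w : List G}
    (hw : w.length = ell F) (hu : u.word ≠ w) :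
    PathAlgebra.ofPath k p * ufHom k F (MonomialAlgebra.mkWord k F w) = 0 := by
  change _ ∈ LinearMap.ker (LinearMap.mulLeft k (PathAlgebra.ofPath k p))
  refine (Submodule.span_le.2 ?_ : labelSpan k F w ≤ _) (ufHom_mem_labelSpan k w)
  rintro _ ⟨a, b, q, rfl, rfl⟩
  rw [SetLike.mem_coe, LinearMap.mem_ker, LinearMap.mulLeft_apply]
  refine PathAlgebra.ofPath_mul_of_ne k p q ?_
  rintro rfl
  exact hu (source_eq_of_pathLabel_eq q hw)

/-- The arrow `e` may be replaced by the sum of all arrows with its label when it is followed by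
its target, read as a word. -/
theorem arrow_mul_ufHom (e : UfArrow F) :
    PathAlgebra.ofPath k e.arrow.toPath * ufHom k F (MonomialAlgebra.mkWord k F e.target.word) =
      ufHom k F (MonomialAlgebra.mkWord k F e.word) := by
  classical
  rw [← e.label_cons, ← List.singleton_append, MonomialAlgebra.mkWord_append, map_mul]
  change _ = ufHom k F (letter k F e.label) * _
  rw [ufHom_letter, labelSum, Finset.sum_mul, Finset.sum_eq_single e]
  · intro e' he' hne
    refine ofPath_mul_ufHom_of_ne k _ e.target.length_eq fun h => hne (LegalWord.ext ?_)
    rw [← e'.label_cons, ← e.label_cons, h, (Finset.mem_filter.1 he').2]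
  · intro h
    exact (h (Finset.mem_filter.2 ⟨Finset.mem_univ _, rfl⟩)).elim

/-- A path followed by its endpoint, read as a word, is the image of an element of `A`. -/
theorem ofPath_mul_ufHom {v u : UfVertex F} (p : Quiver.Path v u) :
    PathAlgebra.ofPath k p * ufHom k F (MonomialAlgebra.mkWord k F u.word) =
      ufHom k F (MonomialAlgebra.mkWord k F (pathLabel p ++ u.word)) := by
  induction p with
  | nil =>
    conv_rhs => rw [pathLabel, List.nil_append, ← one_mul (ufHom k F _), PathAlgebra.one_def,
      Finset.sum_mul]
    rw [Finset.sum_eq_single v]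
    · intro a _ ha
      exact ofPath_mul_ufHom_of_ne k _ v.length_eq fun h => ha (LegalWord.ext h)
    · simp
  | @cons u t p e ih =>
    obtain ⟨e, rfl, rfl⟩ := e
    obtain ⟨y, hy⟩ := e.source_append
    change PathAlgebra.ofPath k (p.comp e.arrow.toPath) * _ =
      ufHom k F (MonomialAlgebra.mkWord k F (pathLabel (p.cons e.arrow) ++ e.target.word))
    rw [pathLabel_cons_arrow, ← PathAlgebra.ofPath_mul_comp, mul_assoc, arrow_mul_ufHom,
      List.append_assoc,
      List.singleton_append, e.label_cons, hy, MonomialAlgebra.mkWord_append, map_mul, ← mul_assoc,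
      ih, ← map_mul, ← MonomialAlgebra.mkWord_append, List.append_assoc]

open Classical in
/-- The linear map `kQ(A) → A` sending a path to its label followed by `w` if the path ends at `w`,
and to `0` otherwise. -/
def wordSection (w : List G) : UfAlgebra k F →ₗ[k] MonomialAlgebra k F :=
  (Finsupp.linearCombination k fun p : AnyPath (UfVertex F) =>
    if p.2.1.word = w then MonomialAlgebra.mkWord k F (pathLabel p.2.2 ++ w) else 0 :
      (AnyPath (UfVertex F) →₀ k) →ₗ[k] _)

open Classical in
theorem wordSection_ofPath (w : List G) {v u : UfVertex F} (p : Quiver.Path v u) :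
    wordSection k w (PathAlgebra.ofPath k p) =
      if u.word = w then MonomialAlgebra.mkWord k F (pathLabel p ++ w) else 0 := by
  rw [wordSection, PathAlgebra.ofPath]
  erw [Finsupp.linearCombination_single, one_smul]

/-- Multiplying a path starting at `v` by `f x` on the left prolongs it by the only arrow labelled
`x` with target `v`, if the word `x v` is legal; if it is not, both sides vanish, because the label
of the path followed by its endpoint begins with `v`. -/
theorem wordSection_letter_mul (w : List G) (x : G) (b : UfAlgebra k F) :
    wordSection k w (ufHom k F (letter k F x) * b) = letter k F x * wordSection k w b := by
  classical
  induction b using PathAlgebra.path_induction with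
  | zero => rw [mul_zero, map_zero, mul_zero]
  | add b b' h h' => rw [mul_add, map_add, h, h', map_add, mul_add]
  | smul c b h => rw [mul_smul_comm, map_smul, h, map_smul, mul_smul_comm]
  | path v u p =>
  rw [ufHom_letter, labelSum, Finset.sum_mul, map_sum, wordSection_ofPath]
  have key (e : UfArrow F) (he : e.label = x) :
      wordSection k w (PathAlgebra.ofPath k e.arrow.toPath * PathAlgebra.ofPath k p) =
        if e.target = v then letter k F x * (if u.word = w then
          MonomialAlgebra.mkWord k F (pathLabel p ++ w) else 0) else 0 := by
    split_ifs with h1 h2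
    · subst h1
      rw [PathAlgebra.ofPath_mul_comp, wordSection_ofPath, if_pos h2, pathLabel_comp, letter,
        ← MonomialAlgebra.mkWord_append, ← he, List.append_assoc, Quiver.Hom.toPath,
        pathLabel_cons_arrow]
      simp [pathLabel]
    · subst h1
      rw [PathAlgebra.ofPath_mul_comp, wordSection_ofPath, if_neg h2, mul_zero]
    · rw [PathAlgebra.ofPath_mul_of_ne _ _ _ h1, map_zero]
  rw [Finset.sum_congr rfl fun e he => key e (Finset.mem_filter.1 he).2]
  by_cases hleg : Legal F (x :: v.word)
  · let e : UfArrow F := ⟨x :: v.word, hleg, by rw [List.length_cons, v.length_eq]⟩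
    have het : e.target = v := rfl
    rw [Finset.sum_eq_single e, if_pos het]
    · intro e' he' hne
      refine if_neg fun h => hne (LegalWord.ext ?_)
      rw [← e'.label_cons, h, (Finset.mem_filter.1 he').2]
    · intro h
      exact (h (Finset.mem_filter.2 ⟨Finset.mem_univ _, rfl⟩)).elim
  · rw [Finset.sum_eq_zero]
    · split_ifs with h
      · subst h
        rw [letter, ← MonomialAlgebra.mkWord_append, mkWord_eq_zero_of_not_legal]
        intro hl
        obtain ⟨t, ht⟩ := source_prefix p
        refine hleg (hl.of_infix (List.IsPrefix.isInfix ⟨t, ?_⟩))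
        rw [← ht]
        rfl
      · rw [mul_zero]
    · intro e he
      refine if_neg fun h => hleg ?_
      rw [← h, ← (Finset.mem_filter.1 he).2, e.label_cons]
      exact e.legal

theorem wordSection_mul (w : List G) (a : MonomialAlgebra k F) (b : UfAlgebra k F) :
    wordSection k w (ufHom k F a * b) = a * wordSection k w b := by
  induction a using MonomialAlgebra.word_induction with
  | zero => rw [map_zero, zero_mul, zero_mul, map_zero]
  | add a a' h h' => rw [map_add, add_mul, map_add, h, h', add_mul]
  | smul c a h => rw [map_smul, smul_mul_assoc, map_smul, h, smul_mul_assoc]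
  | word t =>
    rw [← prod_map_letter]
    induction t with
    | nil => simp
    | cons x t ih => rw [List.map_cons, List.prod_cons, map_mul (ufHom k F),
        mul_assoc, wordSection_letter_mul, ih, mul_assoc]

theorem hasWordSections_ufHom : GrMod.HasWordSections (ufHom k F) (letter k F) (ell F) := by
  classical
  intro w hw
  refine ⟨wordSection k w, wordSection_mul k w, ?_, fun b => ?_⟩
  · rw [prod_map_letter, PathAlgebra.one_def, map_sum]
    simp only [wordSection_ofPath, pathLabel, List.nil_append]
    by_cases hleg : Legal F w
    · rw [Finset.sum_eq_single (⟨w, hleg, hw⟩ : UfVertex F), if_pos rfl]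
      · exact fun v _ hv => if_neg fun h => hv (LegalWord.ext h)
      · exact fun h => (h (Finset.mem_univ _)).elim
    · rw [mkWord_eq_zero_of_not_legal k hleg]
      simp
  · rw [prod_map_letter]
    induction b using PathAlgebra.path_induction with
    | zero => rw [map_zero, map_zero, zero_mul]
    | add b b' h h' => rw [map_add, map_add, h, h', add_mul]
    | smul c b h => rw [map_smul, map_smul, h, smul_mul_assoc]
    | path v u p =>
    rw [wordSection_ofPath]
    split_ifs with h
    · subst h
      exact (ofPath_mul_ufHom k p).symm
    · rw [map_zero, ofPath_mul_ufHom_of_ne k p hw h]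

/-- `T_A` consists of the graded `kQ(A)`-modules each of whose elements is killed by the images of
all words of some length. -/
theorem TA_eq_torsion (deg : G → ℕ) (hdeg : ∀ x, 1 ≤ deg x) :
    TA.{u, v, w} k F deg = GrMod.torsion (grKQ k F deg) (ufHom k F ∘ letter k F) := by
  ext N
  change GrMod.Fdim (grA k F deg) _ ↔ _
  rw [GrMod.Fdim_eq_torsion hdeg]
  exact forall_congr' fun m => GrMod.isTors_restrict_iff _ (ufHom_mem k F deg) m

end Ufnarovskii

end MonomialQGr

end

theorem proposition4p1 (k : Type u) [Field k] {G : Type v} [Finite G] (F : Finset (List G))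
    (deg : G → ℕ) (hdeg : ∀ x, 1 ≤ deg x) :
    MonomialQGr.GrMod.IsLocalizing
        (MonomialQGr.GrMod.Fdim.{u, max u v, max u v w} (MonomialQGr.grA k F deg)) ∧
      MonomialQGr.GrMod.IsLocalizing (MonomialQGr.TA.{u, v, max u v w} k F deg) ∧
      ∃ Φ : MonomialQGr.GrMod.QGr.{u, max u v, max u v w} (MonomialQGr.grA k F deg) ⥤
          MonomialQGr.GrMod.QuotCat (MonomialQGr.TA.{u, v, max u v w} k F deg),
        Φ.IsEquivalence ∧
          Nonempty (MonomialQGr.GrMod.toQuot (MonomialQGr.GrMod.Fdim (MonomialQGr.grA k F deg)) ⋙ Φ ≅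
            MonomialQGr.tensorKQ.{u, v, w} k F deg ⋙
              MonomialQGr.GrMod.toQuot (MonomialQGr.TA k F deg)) := by
  have hA := MonomialQGr.GrMod.Fdim_eq_torsion.{u, v, max u v w} (k := k) (F := F) hdeg
  have hQ := MonomialQGr.TA_eq_torsion.{u, v, max u v w} k (F := F) deg hdeg
  exact ⟨hA ▸ MonomialQGr.GrMod.isLocalizing_torsion _,
    hQ ▸ MonomialQGr.GrMod.isLocalizing_torsion _,
    MonomialQGr.GrMod.exists_equivalence_of_eq_torsion.{u, max u v, max u v, w}
      (MonomialQGr.ufHom_mem k F deg) (MonomialQGr.hasWordSections_ufHom k) hA hQ⟩
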